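/- A test matrix is an $m\times n$ matrix $M$ over $\{0,1\}$; its rows are tests and its columns $M^{(1)},\dots,M^{(n)}$ correspond to items. For $I\subseteq[n]$ let $T(I,M)=\bigvee_{i\in I}M^{(i)}\in\{0,1\}^m$. The matrix $M$ is $(n,I)$-disjunct if for every $i\notin I$ there is a row $t$ with $M_{t,i}=1$ and $M_{t,j}=0$ for all $j\in I$. For $|I|\le d$, $M$ is $(n,I)$-separable if $T(J,M)\ne T(I,M)$ for every $J\ne I$ with $|J|\le d$ (the answers determine $I$ among all sets of at most $d$ items). In the random $s$-set design (RsSD) the columns of $M$ are independent and each is uniformly distributed on the vectors of weight $s$ in $\{0,1\}^m$. Fix a constant $\delta\in(0,1)$. Let $m^D_{RsSD}(n,d)$ (respectively $m_{RsSD}(n,d)$) be the least $m$ for which there is a weight $s\in\{0,\dots,m\}$ such that, for every $I\subseteq[n]$ with $|I|\le d$, the RsSD matrix is $(n,I)$-disjunct (respectively $(n,I)$-separable) with probability at least $1-\delta$. Let $H(p)=-p\log_2p-(1-p)\log_2(1-p)$, with $H(0)=H(1)=0$. Then for every $d\ge1$ the limit $c^D_{RsSD}(d)=\lim_{n\to\infty}m^D_{RsSD}(n,d)/\ln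 n$ exists and $$c^D_{RsSD}(d)=\frac{1}{(\ln 2)\,\max_{0<x\le d}\left(H(\alpha)-\beta H(\alpha/\beta)\right)},\qquad \alpha=\frac xd,\quad \beta=1-(1-\alpha)^d,$$ where the maximum is attained and positive. Moreover $$\lim_{d\to\infty}\frac{c^D_{RsSD}(d)}{d}=\frac1{(\ln2)^2}\approx2.081 ,$$ and $c_{RsSD}=1/(\ln2)^2$ as well, that is, $$\lim_{d\to\infty}\frac1d\limsup_{n\to\infty}\frac{m_{RsSD}(n,d)}{\ln n}=\lim_{d\to\infty}\frac1d\liminf_{n\to\infty}\frac{m_{RsSD}(n,d)}{\ln n}=\frac1{(\ln2)^2}.$$ In particular, if $c_{RsSD}(d)=\lim_{n\to\infty}m_{RsSD}(n,d)/\ln n$ exists for all large $d$, then $\lim_{d\to\infty}c_{RsSD}(d)/d=1/(\ln2)^2$. -/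

import Mathlib

open Filter Topology MeasureTheory

/-- The vector of answers `T(I, M)` of the tests: the bitwise "or" of the columns of the test
matrix `M` (rows are tests, columns are items) that are indexed by `I`. -/
noncomputable def answers {m n : ℕ} (M : Matrix (Fin m) (Fin n) Bool) (I : Finset (Fin n)) : Fin m → Bool :=
  fun t => I.sup fun i => M t i

/-- `M` is `(n, I)`-disjunct: every item outside `I` occurs in a test without any item of `I`. -/
def IsDisjunctFor {m n : ℕ} (M : Matrix (Fin m) (Fin n) Bool) (I : Finset (Fin n)) : Prop :=
  ∀ i, i ∉ I → ∃ t, M t i = true ∧ ∀ j ∈ I, M t j = false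

/-- `M` is `(n, I)`-separable, for at most `d` defective items: `I` is the only set of at most `d`
items that is consistent with the answers of the tests. -/
def IsSeparableFor {m n : ℕ} (d : ℕ) (M : Matrix (Fin m) (Fin n) Bool) (I : Finset (Fin n)) :
    Prop :=
  ∀ J : Finset (Fin n), J.card ≤ d → J ≠ I → answers M J ≠ answers M I

/-- The vectors of weight `s` in `{0,1}^m`. -/
def weightVectors (m s : ℕ) : Set (Fin m → Bool) :=
  {v | (Finset.univ.filter fun t => v t = true).card = s}

/-- The law of the tuple of columns of a random `m × n` matrix in the random `s`-set design:
the `n` columns are independent and each is uniform on the vectors of weight `s`. -/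
noncomputable def rssdLaw (m n s : ℕ) : Measure (Fin n → Fin m → Bool) :=
  Measure.pi fun _ => ProbabilityTheory.uniformOn (weightVectors m s)

/-- The probability that a random `m × n` matrix of the random `s`-set design satisfies `P`. -/
noncomputable def rssdProb (m n s : ℕ) (P : Matrix (Fin m) (Fin n) Bool → Prop) : ℝ :=
  (rssdLaw m n s).real {C | P (Matrix.of C).transpose}

/-- The least number `m` of tests for which, with a suitable column weight `s`, for every set `I`
of at most `d` items the random matrix is `(n, I)`-disjunct with probability at least `1 - δ`. -/
noncomputable def minTestsDisjunct (δ : ℝ) (n d : ℕ) : ℕ :=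
  sInf {m | ∃ s ≤ m, ∀ I : Finset (Fin n), I.card ≤ d →
    1 - δ ≤ rssdProb m n s fun M => IsDisjunctFor M I}

/-- The least number `m` of tests for which, with a suitable column weight `s`, for every set `I`
of at most `d` items the answers identify `I` among all sets of at most `d` items with
probability at least `1 - δ`. -/
noncomputable def minTests (δ : ℝ) (n d : ℕ) : ℕ :=
  sInf {m | ∃ s ≤ m, ∀ I : Finset (Fin n), I.card ≤ d →
    1 - δ ≤ rssdProb m n s fun M => IsSeparableFor d M I}

/-- The upper limit of `minTests δ n d / ln n` as `n → ∞`. -/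
noncomputable def upperConst (δ : ℝ) (d : ℕ) : EReal :=
  limsup (fun n : ℕ => (((minTests δ n d : ℝ) / Real.log n : ℝ) : EReal)) atTop

/-- The lower limit of `minTests δ n d / ln n` as `n → ∞`. -/
noncomputable def lowerConst (δ : ℝ) (d : ℕ) : EReal :=
  liminf (fun n : ℕ => (((minTests δ n d : ℝ) / Real.log n : ℝ) : EReal)) atTop

/-- The binary entropy in bits, `H(p) = - p log₂ p - (1 - p) log₂ (1 - p)`. -/
noncomputable def entropyBits (p : ℝ) : ℝ :=
  -p * Real.logb 2 p - (1 - p) * Real.logb 2 (1 - p)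

/-- `H(α) - β H(α / β)` with `α = x / d` and `β = 1 - (1 - α) ^ d`. -/
noncomputable def rssdRate (d : ℕ) (x : ℝ) : ℝ :=
  let α := x / d
  let β := 1 - (1 - α) ^ d
  entropyBits α - β * entropyBits (α / β)

/-!
Disjunctness for `I` fails when some column outside `I` lies inside the set of tests covered by the
columns of `I`. Given that this set has `w` elements, each further column lies inside it
independently with probability `C(w, s) / C(m, s)` (`rssdProb_isDisjunctFor`), and Chebyshev's
inequality shows that `w / m` is close to `β = 1 - (1 - s / m) ^ |I|`
(`prodMean_card_coveredTests_deviation`); the events that two tests stay uncovered are negatively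
correlated, which bounds the variance by `m`. By Stirling's formula the probability above is
`exp (-m F(s / m, w / m))` up to a factor polynomial in `m`, where
`F(a, b) = η(1 - a) + η(b) - η(b - a)` with `η(x) = -x ln x` is `H(a) - b H(a / b)` in nats
(`coverRatio_le_exp`, `exp_le_coverRatio`). About `n` columns have to avoid being covered, so the
threshold for `m` is `ln n` divided by the maximum `G(d)` of `F(a, 1 - (1 - a) ^ d)` over `a`:
above it the union bound works for the optimal weight
(`eventually_exists_isIrredundantFor`), below it every weight fails
(`eventually_le_of_isDisjunctFor`).

For `a = x / d` the rate `F(a, β)` is `-(x / d) ln (1 - e ^ (-x))` up to `O(1 / d ^ 2)`; since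
`ln u ln (1 - u) ≤ (ln 2) ^ 2`, with equality at `u = 1 / 2`, this gives `d G(d) → (ln 2) ^ 2`
(`tendsto_mul_maxRate`).

For separability, the union bound also covers the columns of `I` itself: if no column, inside or
outside `I`, is covered by the other columns of `I`, then `M` is both disjunct and separable for
`I`. Conversely, if `|I| < d` then a column covered by `I` can be added to `I` without changing the
answers, so that separability for `d` is at least as hard as disjunctness for `d - 1`. Hence the
constants for separability lie between `1 / G(d - 1)` and `1 / G(d)`, which agree after division
by `d` in the limit.
-/

/-! ### Means over independent coordinates -/

/-- The mean of `f` over families `C : ι → X` whose coordinates are independent with weights `w`. -/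
noncomputable def prodMean {ι X : Type*} [Fintype ι] [DecidableEq ι] [Fintype X] (w : X → ℝ)
    (f : (ι → X) → ℝ) : ℝ :=
  ∑ C : ι → X, (∏ i, w (C i)) * f C

section ProdMean

variable {ι X : Type*} [Fintype ι] [DecidableEq ι] [Fintype X] {w : X → ℝ}

lemma prodMean_mono (hw : ∀ v, 0 ≤ w v) {f g : (ι → X) → ℝ}
    (h : ∀ C, (∀ i, w (C i) ≠ 0) → f C ≤ g C) :
    prodMean w f ≤ prodMean w g := by
  refine Finset.sum_le_sum fun C _ => ?_
  by_cases hC : ∀ i, w (C i) ≠ 0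
  · exact mul_le_mul_of_nonneg_left (h C hC) (Finset.prod_nonneg fun i _ => hw _)
  · push Not at hC
    obtain ⟨i, hi⟩ := hC
    have h0 : ∏ j, w (C j) = 0 := Finset.prod_eq_zero (Finset.mem_univ i) hi
    simp [h0]

lemma prodMean_add (f g : (ι → X) → ℝ) :
    prodMean w (fun C => f C + g C) = prodMean w f + prodMean w g := by
  simp [prodMean, mul_add, Finset.sum_add_distrib]

lemma prodMean_mul_left (c : ℝ) (f : (ι → X) → ℝ) :
    prodMean w (fun C => c * f C) = c * prodMean w f := by
  simp only [prodMean, Finset.mul_sum]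
  exact Finset.sum_congr rfl fun C _ => by ring

lemma prodMean_sum {κ : Type*} (s : Finset κ) (f : κ → (ι → X) → ℝ) :
    prodMean w (fun C => ∑ k ∈ s, f k C) = ∑ k ∈ s, prodMean w (f k) := by
  simp only [prodMean, Finset.mul_sum]
  exact Finset.sum_comm

lemma prodMean_prod (g : ι → X → ℝ) :
    prodMean w (fun C => ∏ i, g i (C i)) = ∏ i, ∑ v, w v * g i v := by
  rw [Fintype.prod_sum]
  simp [prodMean, Finset.prod_mul_distrib]

lemma prodMean_const (hw : ∑ v, w v = 1) (c : ℝ) :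
    prodMean w (fun _ : ι → X => c) = c := by
  have h := prodMean_mul_left (ι := ι) (w := w) c fun _ => 1
  have h1 := prodMean_prod (ι := ι) (w := w) fun _ _ => 1
  simp only [Finset.prod_const_one, mul_one, hw] at h h1
  rw [h, h1, mul_one]

/-- The mean of a product over the coordinates in `K`. -/
lemma prodMean_prod_finset (hw : ∑ v, w v = 1) (K : Finset ι) (g : X → ℝ) :
    prodMean w (fun C => ∏ i ∈ K, g (C i)) = (∑ v, w v * g v) ^ K.card := by
  have h := prodMean_prod (w := w) fun i v => if i ∈ K then g v else 1
  have h2 : ∀ i, ∑ v, w v * (if i ∈ K then g v else 1) = if i ∈ K then ∑ v, w v * g v else 1 := by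
    intro i
    split_ifs <;> simp [hw]
  simp only [h2, Finset.prod_ite_mem, Finset.univ_inter, Finset.prod_const] at h
  exact h

/-- Integrating out the coordinates outside `K`: if `φ` and `h` depend on the coordinates in `K`
only, then, given these, the other coordinates are still independent. -/
lemma prodMean_mul_prod_compl (hw : ∑ v, w v = 1) (K : Finset ι) (φ : (ι → X) → ℝ)
    (h : (ι → X) → ι → X → ℝ)
    (hφ : ∀ C C' : ι → X, (∀ i ∈ K, C i = C' i) → φ C = φ C')
    (hh : ∀ C C' : ι → X, (∀ i ∈ K, C i = C' i) → h C = h C') :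
    prodMean w (fun C => φ C * ∏ i ∈ Kᶜ, h C i (C i)) =
      prodMean w (fun C => φ C * ∏ i ∈ Kᶜ, ∑ v, w v * h C i v) := by
  obtain ⟨v₀⟩ : Nonempty X := by
    by_contra hX
    rw [not_nonempty_iff] at hX
    simp at hw
  let e := (Equiv.piEquivPiSubtypeProd (fun i => i ∈ K) fun _ : ι => X)
  have key : ∀ f : (ι → X) → ℝ, prodMean w f =
      ∑ x : {i // i ∈ K} → X, (∏ i, w (x i)) *
        prodMean w (fun z : {i // i ∉ K} → X => f (e.symm (x, z))) := by
    intro f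
    rw [prodMean, ← e.symm.sum_comp, Fintype.sum_prod_type]
    refine Finset.sum_congr rfl fun x _ => ?_
    rw [prodMean, Finset.mul_sum]
    refine Finset.sum_congr rfl fun z _ => ?_
    rw [← Fintype.prod_subtype_mul_prod_subtype (fun i => i ∈ K), mul_assoc]
    congr 1
    · exact Finset.prod_congr (by ext; simp) fun i _ => by simp [e, i.2]
    · congr 1
      exact Finset.prod_congr rfl fun i _ => by simp [e, i.2]
  have hprod : ∀ g : ι → ℝ, ∏ i ∈ Kᶜ, g i = ∏ i : {i // i ∉ K}, g i := fun g =>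
    Finset.prod_subtype _ (by simp) _
  rw [key, key]
  refine Finset.sum_congr rfl fun x _ => ?_
  congr 1
  let D := e.symm (x, fun _ => v₀)
  have hD : ∀ z, ∀ i ∈ K, e.symm (x, z) i = D i := by
    intro z i hi
    simp [e, D, hi]
  have h1 : ∀ z, φ (e.symm (x, z)) = φ D := fun z => hφ _ _ (hD z)
  have h2 : ∀ z, h (e.symm (x, z)) = h D := fun z => hh _ _ (hD z)
  have h3 : ∀ z : {i // i ∉ K} → X, ∀ i : {i // i ∉ K}, e.symm (x, z) i = z i := by
    intro z i
    simp [e, i.2]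
  simp only [h1, h2, hprod, h3, prodMean_mul_left, prodMean_const hw]
  rw [prodMean_prod (fun (i : {i // i ∉ K}) v => h D i v)]

end ProdMean

/-! ### The columns of the random set design -/

/-- The probability of the column `v`: the uniform distribution on the vectors of weight `s`. -/
noncomputable def columnWeight (m s : ℕ) (v : Fin m → Bool) : ℝ :=
  if (Finset.univ.filter fun t => v t = true).card = s then 1 / (m.choose s : ℝ) else 0

/-- The proportion of the `s`-subsets of an `m`-set that lie in a given `a`-subset. -/
noncomputable def coverRatio (m s a : ℕ) : ℝ := (a.choose s : ℝ) / m.choose s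

lemma coverRatio_nonneg (m s a : ℕ) : 0 ≤ coverRatio m s a := by unfold coverRatio; positivity

lemma coverRatio_le_one {m s a : ℕ} (ha : a ≤ m) : coverRatio m s a ≤ 1 :=
  div_le_one_of_le₀ (by exact_mod_cast Nat.choose_le_choose s ha) (by positivity)

lemma columnWeight_nonneg (m s : ℕ) (v : Fin m → Bool) : 0 ≤ columnWeight m s v := by
  unfold columnWeight; split_ifs <;> positivity

lemma card_of_columnWeight_ne_zero {m s : ℕ} {v : Fin m → Bool} (h : columnWeight m s v ≠ 0) :
    (Finset.univ.filter fun t => v t = true).card = s := by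
  by_contra h'
  exact h (by simp [columnWeight, h'])

/-- The set of the `true` coordinates identifies Boolean vectors with sets. -/
def boolVecEquiv (m : ℕ) : (Fin m → Bool) ≃ Finset (Fin m) where
  toFun v := Finset.univ.filter fun t => v t = true
  invFun A := fun t => decide (t ∈ A)
  left_inv v := by ext t; simp
  right_inv A := by ext t; simp

lemma card_weight_filter (m s : ℕ) (A : Finset (Fin m)) :
    (Finset.univ.filter fun v : Fin m → Bool =>
      (Finset.univ.filter fun t => v t = true).card = s ∧ ∀ t, v t = true → t ∈ A).card =
      A.card.choose s := by
  rw [← Finset.card_powersetCard]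
  refine Finset.card_equiv (boolVecEquiv m) fun v => ?_
  simp only [Finset.mem_filter, Finset.mem_univ, true_and, Finset.mem_powersetCard, boolVecEquiv,
    Equiv.coe_fn_mk, Finset.subset_iff]
  tauto

/-- The probability that a column is contained in the set `A` of tests. -/
lemma sum_columnWeight_subset (m s : ℕ) (A : Finset (Fin m)) :
    ∑ v, columnWeight m s v * (if ∀ t, v t = true → t ∈ A then 1 else 0) =
      coverRatio m s A.card := by
  rw [coverRatio, ← card_weight_filter, Finset.card_eq_sum_ones, Finset.sum_filter]
  push_cast
  rw [Finset.sum_div]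
  refine Finset.sum_congr rfl fun v _ => ?_
  unfold columnWeight
  split_ifs <;> first | tauto | simp

lemma sum_columnWeight {m s : ℕ} (hs : s ≤ m) : ∑ v, columnWeight m s v = 1 := by
  have h := sum_columnWeight_subset m s Finset.univ
  have : (m.choose s : ℝ) ≠ 0 := by exact_mod_cast (Nat.choose_pos hs).ne'
  simpa [coverRatio, this] using h

open Classical in
/-- Probabilities in the random set design are means over independent columns. -/
lemma rssdProb_eq_prodMean {m n s : ℕ} (P : Matrix (Fin m) (Fin n) Bool → Prop) :
    rssdProb m n s P =
      prodMean (columnWeight m s) (fun C => if P (Matrix.of C).transpose then 1 else 0) := by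
  have hV : weightVectors m s = ((Finset.univ.filter fun v : Fin m → Bool =>
      (Finset.univ.filter fun t => v t = true).card = s : Finset _) : Set (Fin m → Bool)) := by
    ext v; simp [weightVectors]
  have hcard := card_weight_filter m s Finset.univ
  simp only [Finset.mem_univ, implies_true, and_true, Finset.card_univ, Fintype.card_fin] at hcard
  have hsing : ∀ v, (ProbabilityTheory.uniformOn (weightVectors m s)).real {v} =
      columnWeight m s v := by
    intro v
    rw [hV, measureReal_def, ← Finset.coe_singleton, ProbabilityTheory.uniformOn_apply_finset,
      hcard]
    unfold columnWeight
    by_cases h : (Finset.univ.filter fun t => v t = true).card = s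
    · rw [Finset.inter_singleton_of_mem (by simpa using h)]
      simp [h]
    · rw [Finset.inter_singleton_of_notMem (by simpa using h)]
      simp [h]
  have : IsFiniteMeasure (ProbabilityTheory.uniformOn (weightVectors m s)) := by
    unfold ProbabilityTheory.uniformOn; infer_instance
  have hset : {C : Fin n → Fin m → Bool | P (Matrix.of C).transpose} =
      ((Finset.univ.filter fun C : Fin n → Fin m → Bool => P (Matrix.of C).transpose : Finset _) :
        Set (Fin n → Fin m → Bool)) := by ext; simp
  rw [rssdProb, rssdLaw, hset, ← sum_measureReal_singleton, Finset.sum_filter, prodMean]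
  refine Finset.sum_congr rfl fun C _ => ?_
  rw [measureReal_def, Measure.pi_singleton, ENNReal.toReal_prod]
  simp only [← measureReal_def, hsing]
  split_ifs <;> simp

/-! ### The tests covered by a set of columns -/

section Covered

variable {m n : ℕ}

/-- The tests that contain an item of `K`, where `C` is the family of the columns. -/
def coveredTests (C : Fin n → Fin m → Bool) (K : Finset (Fin n)) : Finset (Fin m) :=
  Finset.univ.filter fun t => ∃ i ∈ K, C i t = true

lemma coveredTests_congr {C C' : Fin n → Fin m → Bool} {K : Finset (Fin n)}
    (h : ∀ i ∈ K, C i = C' i) : coveredTests C K = coveredTests C' K := by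
  ext t
  simp only [coveredTests, Finset.mem_filter, Finset.mem_univ, true_and]
  exact exists_congr fun i => and_congr_right fun hi => by rw [h i hi]

lemma card_coveredTests_le (C : Fin n → Fin m → Bool) (K : Finset (Fin n)) :
    (coveredTests C K).card ≤ m := by
  simpa using Finset.card_le_univ (coveredTests C K)

lemma le_card_coveredTests {s : ℕ} {C : Fin n → Fin m → Bool} {K : Finset (Fin n)}
    (hK : K.Nonempty) (hC : ∀ i, columnWeight m s (C i) ≠ 0) : s ≤ (coveredTests C K).card := by
  obtain ⟨i, hi⟩ := hK
  rw [← card_of_columnWeight_ne_zero (hC i)]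
  refine Finset.card_le_card fun t ht => ?_
  simp only [coveredTests, Finset.mem_filter, Finset.mem_univ, true_and] at ht ⊢
  exact ⟨i, hi, ht⟩

lemma isDisjunctFor_iff (C : Fin n → Fin m → Bool) (K : Finset (Fin n)) :
    IsDisjunctFor (Matrix.of C).transpose K ↔
      ∀ i ∈ Kᶜ, ¬ ∀ t, C i t = true → t ∈ coveredTests C K := by
  simp [IsDisjunctFor, coveredTests]

/-- The probability that a further column lies in the covered tests, given these. -/
lemma prodMean_mul_contained {s : ℕ} (hs : s ≤ m) (K : Finset (Fin n)) (ψ : Finset (Fin m) → ℝ)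
    {i : Fin n} (hi : i ∉ K) :
    prodMean (columnWeight m s) (fun C => ψ (coveredTests C K) *
      if ∀ t, C i t = true → t ∈ coveredTests C K then 1 else 0) =
    prodMean (columnWeight m s) (fun C => ψ (coveredTests C K) *
      coverRatio m s (coveredTests C K).card) := by
  have h := prodMean_mul_prod_compl (sum_columnWeight hs) K (fun C => ψ (coveredTests C K))
    (fun C j v => if j = i then (if ∀ t, v t = true → t ∈ coveredTests C K then 1 else 0) else 1)
    (fun C C' hC => by rw [coveredTests_congr hC])
    (fun C C' hC => by rw [coveredTests_congr hC])
  have hsum : ∀ (C : Fin n → Fin m → Bool) (j : Fin n), ∑ v, columnWeight m s v *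
      (if j = i then (if ∀ t, v t = true → t ∈ coveredTests C K then (1 : ℝ) else 0) else 1) =
      if j = i then coverRatio m s (coveredTests C K).card else 1 := by
    intro C j
    split_ifs
    · exact sum_columnWeight_subset m s _
    · simpa using sum_columnWeight hs
  simpa only [hsum, Finset.prod_ite_eq', Finset.mem_compl, hi, not_false_eq_true, if_true] using h

/-- Given the columns in `K`, the other columns independently avoid being covered. -/
lemma rssdProb_isDisjunctFor {s : ℕ} (hs : s ≤ m) (K : Finset (Fin n)) :
    rssdProb m n s (fun M => IsDisjunctFor M K) =
      prodMean (columnWeight m s) (fun C =>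
        (1 - coverRatio m s (coveredTests C K).card) ^ (n - K.card)) := by
  have h := prodMean_mul_prod_compl (sum_columnWeight hs) K (fun C => 1)
    (fun C j v => 1 - if ∀ t, v t = true → t ∈ coveredTests C K then 1 else 0)
    (fun C C' hC => rfl) (fun C C' hC => by rw [coveredTests_congr hC])
  have hsum : ∀ C : Fin n → Fin m → Bool, ∑ v, columnWeight m s v *
      (1 - if ∀ t, v t = true → t ∈ coveredTests C K then (1 : ℝ) else 0) =
      1 - coverRatio m s (coveredTests C K).card := by
    intro C
    simp only [mul_sub, mul_one, Finset.sum_sub_distrib, sum_columnWeight hs,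
      sum_columnWeight_subset]
  simp only [hsum, one_mul, Finset.prod_const, Finset.card_compl, Fintype.card_fin] at h
  rw [rssdProb_eq_prodMean, ← h]
  congr 1
  ext C
  rw [isDisjunctFor_iff]
  split_ifs with hC
  · symm
    exact Finset.prod_eq_one fun i hi => by simp [hC i hi]
  · push Not at hC
    obtain ⟨i, hi, hC⟩ := hC
    symm
    exact Finset.prod_eq_zero hi (by rw [if_pos hC, sub_self])

/-- The probability that a column avoids a given test. -/
lemma coverRatio_pred {m s : ℕ} (hm : 0 < m) (hs : s ≤ m) :
    coverRatio m s (m - 1) = 1 - (s : ℝ) / m := by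
  obtain ⟨k, rfl⟩ : ∃ k, m = k + 1 := ⟨m - 1, by omega⟩
  have h := Nat.choose_mul_succ_eq k s
  have h' : (k.choose s : ℝ) * (k + 1) = (k + 1).choose s * (k + 1 - s) := by
    have := congrArg (Nat.cast : ℕ → ℝ) h
    push_cast [Nat.cast_sub hs] at this
    exact this
  have hpos : (0 : ℝ) < (k + 1).choose s := by exact_mod_cast Nat.choose_pos hs
  rw [coverRatio, Nat.add_sub_cancel]
  push_cast
  field_simp
  linarith

/-- The events that a column avoids two given tests are negatively correlated. -/
lemma coverRatio_pred_pred {m s : ℕ} (hm : 2 ≤ m) (hs : s ≤ m) :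
    coverRatio m s (m - 2) ≤ (1 - (s : ℝ) / m) ^ 2 := by
  rcases hs.eq_or_lt with rfl | hlt
  · rw [coverRatio, Nat.choose_eq_zero_of_lt (by omega)]
    simp; positivity
  have h1 := coverRatio_pred (m := m) (by omega) hs
  have h2 := coverRatio_pred (m := m - 1) (s := s) (by omega) (by omega)
  have hpos : (0 : ℝ) < (m - 1).choose s := by exact_mod_cast Nat.choose_pos (by omega)
  have hm1 : (m - 1 : ℕ) = (m : ℝ) - 1 := by push_cast [Nat.cast_sub (show 1 ≤ m by omega)]; ring
  have hm' : (2 : ℝ) ≤ m := by exact_mod_cast hm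
  have hs' : (s : ℝ) ≤ m := by exact_mod_cast hs
  have h3 : coverRatio m s (m - 2) = coverRatio (m - 1) s (m - 1 - 1) * coverRatio m s (m - 1) := by
    simp only [coverRatio, Nat.sub_sub]
    field_simp
  have h4 : (0 : ℝ) ≤ 1 - s / m := by
    rw [sub_nonneg]; exact div_le_one_of_le₀ hs' (by positivity)
  rw [h3, h1, h2, hm1, sq]
  refine mul_le_mul_of_nonneg_right ?_ h4
  have : (s : ℝ) / m ≤ s / (m - 1) := by
    apply div_le_div_of_nonneg_left <;> first | positivity | linarith
  linarith

/-- Chebyshev's inequality for the number of covered tests. -/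
lemma prodMean_card_coveredTests_deviation {s : ℕ} (hm : 0 < m) (hs : s ≤ m) (K : Finset (Fin n))
    {ε : ℝ} (hε : 0 < ε) :
    prodMean (columnWeight m s) (fun C =>
      if |((coveredTests C K).card : ℝ) / m - (1 - (1 - (s : ℝ) / m) ^ K.card)| < ε
      then 0 else 1) ≤ 1 / (ε ^ 2 * m) := by
  set w := columnWeight m s with hw
  have hw1 : ∑ v, w v = 1 := sum_columnWeight hs
  set q : ℝ := 1 - (s : ℝ) / m with hq
  have hm' : (0 : ℝ) < m := by exact_mod_cast hm
  have hq0 : 0 ≤ q := by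
    rw [hq, sub_nonneg]; exact div_le_one_of_le₀ (by exact_mod_cast hs) hm'.le
  have hq1 : q ≤ 1 := by rw [hq]; linarith [show (0 : ℝ) ≤ s / m by positivity]
  let u : Fin m → (Fin n → Fin m → Bool) → ℝ := fun t C =>
    ∏ i ∈ K, if ∀ t', C i t' = true → t' ∈ ({t} : Finset (Fin m))ᶜ then (1 : ℝ) else 0
  have hu : ∀ t C, u t C = if t ∈ coveredTests C K then 0 else 1 := by
    intro t C
    simp only [u, Finset.prod_ite_zero, Finset.prod_const_one]
    have : (∀ i ∈ K, ∀ t', C i t' = true → t' ∈ ({t} : Finset (Fin m))ᶜ) ↔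
        t ∉ coveredTests C K := by
      simp only [coveredTests, Finset.mem_compl, Finset.mem_singleton, Finset.mem_filter,
        Finset.mem_univ, true_and, not_exists, not_and]
      exact forall₂_congr fun i _ => ⟨fun h ht => h t ht rfl, fun h t' ht' e => h (e ▸ ht')⟩
    simp only [this]
    split_ifs <;> rfl
  have hmean : ∀ t, prodMean w (u t) = q ^ K.card := by
    intro t
    rw [prodMean_prod_finset hw1 K
      (fun v => if ∀ t', v t' = true → t' ∈ ({t} : Finset (Fin m))ᶜ then (1 : ℝ) else 0),
      sum_columnWeight_subset, Finset.card_compl, Fintype.card_fin, Finset.card_singleton,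
      coverRatio_pred hm hs]
  have hpair : ∀ t t', prodMean w (fun C => u t C * u t' C) ≤
      (q ^ K.card) ^ 2 + if t = t' then 1 else 0 := by
    intro t t'
    split_ifs with h
    · subst h
      have : (fun C => u t C * u t C) = u t := by
        ext C; rw [hu]; split_ifs <;> simp
      rw [this, hmean]
      nlinarith [pow_le_one₀ (n := K.card) hq0 hq1, sq_nonneg (q ^ K.card)]
    · have : (fun C => u t C * u t' C) = fun C => ∏ i ∈ K,
          if ∀ t'', C i t'' = true → t'' ∈ ({t, t'} : Finset (Fin m))ᶜ then (1 : ℝ) else 0 := by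
        ext C
        simp only [u, ← Finset.prod_mul_distrib]
        refine Finset.prod_congr rfl fun i _ => ?_
        simp only [Finset.mem_compl, Finset.mem_singleton, Finset.mem_insert, not_or]
        rw [ite_zero_mul_ite_zero, mul_one]
        congr 1
        exact propext ⟨fun h a ha => ⟨h.1 a ha, h.2 a ha⟩,
          fun h => ⟨fun a ha => (h a ha).1, fun a ha => (h a ha).2⟩⟩
      have hm2 : 2 ≤ m := by
        have := Finset.card_le_univ ({t, t'} : Finset (Fin m))
        rwa [Finset.card_pair h, Fintype.card_fin] at this
      rw [this, prodMean_prod_finset hw1 K (fun v =>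
        if ∀ t'', v t'' = true → t'' ∈ ({t, t'} : Finset (Fin m))ᶜ then (1 : ℝ) else 0),
        sum_columnWeight_subset, Finset.card_compl, Fintype.card_fin, Finset.card_pair h, add_zero,
        ← pow_mul, mul_comm, pow_mul]
      exact pow_le_pow_left₀ (coverRatio_nonneg _ _ _) (coverRatio_pred_pred hm2 hs) _
  have hvar : prodMean w (fun C => (∑ t, (u t C - q ^ K.card)) ^ 2) ≤ m := by
    have hexp : (fun C => (∑ t, (u t C - q ^ K.card)) ^ 2) = fun C =>
        ∑ t, ∑ t', (u t C * u t' C + (-(q ^ K.card) * u t C + (-(q ^ K.card) * u t' C +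
          (q ^ K.card) ^ 2))) := by
      ext C
      rw [sq, Finset.sum_mul_sum]
      exact Finset.sum_congr rfl fun t _ => Finset.sum_congr rfl fun t' _ => by ring
    rw [hexp, prodMean_sum]
    simp only [prodMean_sum, prodMean_add, prodMean_mul_left, prodMean_const hw1, hmean]
    calc _ ≤ ∑ t : Fin m, ∑ t' : Fin m, (if t = t' then (1 : ℝ) else 0) := by
          refine Finset.sum_le_sum fun t _ => Finset.sum_le_sum fun t' _ => ?_
          have := hpair t t'
          linarith
      _ = m := by simp
  have hcount : ∀ C, ∑ t, (u t C - q ^ K.card) =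
      -(m * (((coveredTests C K).card : ℝ) / m - (1 - q ^ K.card))) := by
    intro C
    have h1 : ∑ t, u t C = m - (coveredTests C K).card := by
      have h2 : ∀ t, u t C = 1 - if t ∈ coveredTests C K then 1 else 0 := by
        intro t; rw [hu]; split_ifs <;> simp
      simp only [h2]
      simp
    rw [Finset.sum_sub_distrib, h1]
    simp
    field_simp
    ring
  calc _ ≤ prodMean w (fun C => (1 / (ε * m) ^ 2) * (∑ t, (u t C - q ^ K.card)) ^ 2) := by
        refine prodMean_mono (columnWeight_nonneg m s) fun C _ => ?_
        split_ifs with hC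
        · positivity
        · rw [hcount, neg_sq, mul_pow, mul_pow, one_div_mul_eq_div, mul_comm (ε ^ 2),
            mul_div_mul_left _ _ (by positivity), one_le_div (by positivity), sq_le_sq,
            abs_of_pos hε]
          exact not_lt.mp hC
    _ ≤ (1 / (ε * m) ^ 2) * m := by
        rw [prodMean_mul_left]
        gcongr
    _ = _ := by field_simp

open Classical in
/-- Union bound over the columns in `S`, on the event that the number of covered tests is close
to its mean. -/
lemma prodMean_exists_contained_le {s : ℕ} (hm : 0 < m) (hs : s ≤ m) (K S : Finset (Fin n))
    (hKS : Disjoint S K) {ε B : ℝ} (hε : 0 < ε) (hB : 0 ≤ B)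
    (h : ∀ a ≤ m, |(a : ℝ) / m - (1 - (1 - (s : ℝ) / m) ^ K.card)| < ε → coverRatio m s a ≤ B) :
    prodMean (columnWeight m s) (fun C : Fin n → Fin m → Bool =>
      if ∃ i ∈ S, ∀ t, C i t = true → t ∈ coveredTests C K then 1 else 0) ≤
        1 / (ε ^ 2 * m) + S.card * B := by
  let good : Finset (Fin m) → ℝ := fun A =>
    if |(A.card : ℝ) / m - (1 - (1 - (s : ℝ) / m) ^ K.card)| < ε then 1 else 0
  have hw := columnWeight_nonneg m s
  calc _ ≤ prodMean (columnWeight m s) (fun C : Fin n → Fin m → Bool =>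
      (if |((coveredTests C K).card : ℝ) / m - (1 - (1 - (s : ℝ) / m) ^ K.card)| < ε
        then 0 else 1) + ∑ i ∈ S, good (coveredTests C K) *
          if ∀ t, C i t = true → t ∈ coveredTests C K then 1 else 0) := by
        refine prodMean_mono hw fun C _ => ?_
        have hnn : ∀ i ∈ S, 0 ≤ good (coveredTests C K) *
          if ∀ t, C i t = true → t ∈ coveredTests C K then (1 : ℝ) else 0 := by
          intro i _
          simp only [good]
          split_ifs <;> simp
        have hsum := Finset.sum_nonneg hnn
        by_cases hg : |((coveredTests C K).card : ℝ) / m - (1 - (1 - (s : ℝ) / m) ^ K.card)| < ε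
        · rw [if_pos hg]
          split_ifs with hC
          · obtain ⟨i, hi, hC⟩ := hC
            have h1 := Finset.single_le_sum hnn hi
            simp only [good, if_pos hg, if_pos hC] at h1
            simp only [good, if_pos hg]
            linarith
          · simpa using hsum
        · rw [if_neg hg]
          split_ifs <;> linarith
    _ ≤ 1 / (ε ^ 2 * m) + ∑ i ∈ S, B := by
        rw [prodMean_add, prodMean_sum]
        refine add_le_add (prodMean_card_coveredTests_deviation hm hs K hε)
          (Finset.sum_le_sum fun i hi => ?_)
        rw [prodMean_mul_contained hs K good (Finset.disjoint_left.mp hKS hi)]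
        refine le_of_le_of_eq ?_ (prodMean_const (ι := Fin n) (sum_columnWeight hs) B)
        refine prodMean_mono hw fun C _ => ?_
        simp only [good]
        split_ifs with hg
        · rw [one_mul]
          exact h _ (card_coveredTests_le C K) hg
        · simpa using hB
    _ = _ := by simp

/-- An upper bound for the probability of disjunctness, when all typical numbers of covered tests
give a further column a chance of at least `r` to be covered. -/
lemma rssdProb_isDisjunctFor_le {s : ℕ} (hm : 0 < m) (hs : s ≤ m) (K : Finset (Fin n))
    (hK : K.Nonempty) {ε r : ℝ} (hε : 0 < ε) (hr : r ≤ 1)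
    (h : ∀ a, s ≤ a → a ≤ m → |(a : ℝ) / m - (1 - (1 - (s : ℝ) / m) ^ K.card)| < ε →
      r ≤ coverRatio m s a) :
    rssdProb m n s (fun M => IsDisjunctFor M K) ≤ 1 / (ε ^ 2 * m) + (1 - r) ^ (n - K.card) := by
  rw [rssdProb_isDisjunctFor hs]
  have hnn : 0 ≤ (1 - r) ^ (n - K.card) := pow_nonneg (by linarith) _
  calc _ ≤ prodMean (columnWeight m s) (fun C : Fin n → Fin m → Bool =>
      (if |((coveredTests C K).card : ℝ) / m - (1 - (1 - (s : ℝ) / m) ^ K.card)| < ε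
        then 0 else 1) + (1 - r) ^ (n - K.card)) := by
        refine prodMean_mono (columnWeight_nonneg m s) fun C hC => ?_
        have h0 := coverRatio_nonneg m s (coveredTests C K).card
        have h1 := coverRatio_le_one (s := s) (card_coveredTests_le C K)
        split_ifs with hg
        · rw [zero_add]
          have := h _ (le_card_coveredTests hK hC) (card_coveredTests_le C K) hg
          exact pow_le_pow_left₀ (by linarith) (by linarith) _
        · have : (1 - coverRatio m s (coveredTests C K).card) ^ (n - K.card) ≤ 1 :=
            pow_le_one₀ (by linarith) (by linarith)
          linarith
    _ ≤ _ := by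
        rw [prodMean_add, prodMean_const (sum_columnWeight hs)]
        gcongr
        exact prodMean_card_coveredTests_deviation hm hs K hε

/-- The bound that remains useful for few tests: a column coincides with a given column of `K`
with probability at least `2 ^ (-m)`. -/
lemma rssdProb_isDisjunctFor_le_two_pow {s : ℕ} (hs : s ≤ m) (K : Finset (Fin n))
    (hK : K.Nonempty) :
    rssdProb m n s (fun M => IsDisjunctFor M K) ≤ (1 - 1 / 2 ^ m) ^ (n - K.card) := by
  rw [rssdProb_isDisjunctFor hs]
  refine le_of_le_of_eq ?_ (prodMean_const (ι := Fin n) (sum_columnWeight hs) _)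
  refine prodMean_mono (columnWeight_nonneg m s) fun C hC => ?_
  have h1 := coverRatio_le_one (s := s) (card_coveredTests_le C K)
  have h2 : (1 : ℝ) / 2 ^ m ≤ coverRatio m s (coveredTests C K).card := by
    unfold coverRatio
    have h3 : (1 : ℝ) ≤ (coveredTests C K).card.choose s := by
      exact_mod_cast Nat.choose_pos (le_card_coveredTests hK hC)
    have h4 : (m.choose s : ℝ) ≤ 2 ^ m := by exact_mod_cast Nat.choose_le_two_pow m s
    have h5 : (0 : ℝ) < m.choose s := by exact_mod_cast Nat.choose_pos hs
    gcongr
  exact pow_le_pow_left₀ (by linarith) (by linarith) _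

end Covered

/-! ### Exponential rate of the covering probability -/

/-- The exponential rate, in nats, at which `C(bm, am) / C(m, am)` decays with `m`. It is
`H(a) - b H(a / b)` rewritten with `-x log x` alone, which is continuous up to the boundary. -/
noncomputable def coverExponent (a b : ℝ) : ℝ :=
  Real.negMulLog (1 - a) + Real.negMulLog b - Real.negMulLog (b - a)

/-- The logarithmic error in the exponential approximation of `coverRatio`. -/
noncomputable def coverError (m : ℕ) : ℝ := 2 * (Real.log (m + 1) + 1)

lemma log_factorial_ge (N : ℕ) : N * Real.log N - N ≤ Real.log N.factorial := by
  rcases Nat.eq_zero_or_pos N with rfl | hN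
  · simp
  have h := Stirling.le_log_factorial_stirling hN.ne'
  have h1 : 0 ≤ Real.log N := Real.log_natCast_nonneg N
  have h2 : 0 ≤ Real.log (2 * Real.pi) := Real.log_nonneg (by nlinarith [Real.pi_gt_three])
  linarith

lemma log_factorial_le (N : ℕ) :
    Real.log N.factorial ≤ N * Real.log N - N + Real.log (N + 1) + 1 := by
  induction N with
  | zero => simp
  | succ N ih =>
    rcases Nat.eq_zero_or_pos N with rfl | hN
    · have : 0 ≤ Real.log (1 + 1) := Real.log_nonneg (by norm_num)
      simpa using this
    have hN' : (1 : ℝ) ≤ N := by exact_mod_cast hN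
    rw [Nat.factorial_succ, Nat.cast_mul,
      Real.log_mul (by positivity) (by exact_mod_cast N.factorial_ne_zero)]
    push_cast
    -- The increments are compared through `N log (1 + 1 / N) ≥ 1 - 1 / (2 N + 1)`, which comes
    -- from `log (1 + x) ≥ 2 x / (x + 2)`.
    have h1 := Real.le_log_one_add_of_nonneg (x := 1 / N) (by positivity)
    have h2 := Real.one_sub_inv_le_log_of_pos (x := ((N : ℝ) + 1 + 1) / (N + 1)) (by positivity)
    rw [Real.log_div (by positivity) (by positivity)] at h2
    rw [show (1 : ℝ) + 1 / N = (N + 1) / N by field_simp,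
      Real.log_div (by positivity) (by positivity)] at h1
    have h3 : (2 : ℝ) * (1 / N) / (1 / N + 2) = 2 / (2 * N + 1) := by
      field_simp
      ring
    rw [h3] at h1
    have h4 := mul_le_mul_of_nonneg_left h1 (show (0 : ℝ) ≤ N by positivity)
    have h5 : (N : ℝ) * (2 / (2 * N + 1)) = 1 - 1 / (2 * N + 1) := by field_simp; ring
    have h6 : 1 - (((N : ℝ) + 1 + 1) / (N + 1))⁻¹ = 1 / (N + 1 + 1) := by field_simp; ring
    have h7 : (1 : ℝ) / (2 * N + 1) ≤ 1 / (N + 1 + 1) := by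
      apply one_div_le_one_div_of_le <;> linarith
    nlinarith

lemma mul_negMulLog_div {m x : ℝ} (hm : 0 < m) :
    m * Real.negMulLog (x / m) = -(x * Real.log x) + x * Real.log m := by
  rcases eq_or_ne x 0 with rfl | hx
  · simp
  rw [Real.negMulLog, Real.log_div hx hm.ne']
  field_simp
  ring

/-- The exponential approximation of `coverRatio`, from Stirling's formula. -/
lemma abs_log_coverRatio_add_le {m s a : ℕ} (hm : 0 < m) (hsa : s ≤ a) (ham : a ≤ m) :
    |Real.log (coverRatio m s a) + m * coverExponent (s / m) (a / m)| ≤ coverError m := by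
  have hm' : (0 : ℝ) < m := by exact_mod_cast hm
  have hsm := hsa.trans ham
  have h1 : coverRatio m s a =
      ((a.factorial : ℝ) * (m - s).factorial) / ((a - s).factorial * m.factorial) := by
    rw [coverRatio, Nat.cast_choose ℝ hsa, Nat.cast_choose ℝ hsm]
    field_simp
  have hf : ∀ N : ℕ, (N.factorial : ℝ) ≠ 0 := fun N => by exact_mod_cast N.factorial_ne_zero
  have e1 : (1 : ℝ) - s / m = ((m - s : ℕ) : ℝ) / m := by
    rw [Nat.cast_sub hsm]; field_simp
  have e2 : (a : ℝ) / m - s / m = ((a - s : ℕ) : ℝ) / m := by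
    rw [Nat.cast_sub hsa]; field_simp
  have h2 : m * coverExponent (s / m) (a / m) =
      -(((m - s : ℕ) : ℝ) * Real.log (m - s : ℕ)) - a * Real.log a +
        ((a - s : ℕ) : ℝ) * Real.log (a - s : ℕ) + m * Real.log m := by
    rw [coverExponent, e1, e2, mul_sub, mul_add, mul_negMulLog_div hm', mul_negMulLog_div hm',
      mul_negMulLog_div hm']
    have e3 : ((m - s : ℕ) : ℝ) + a - (a - s : ℕ) = m := by
      rw [Nat.cast_sub hsm, Nat.cast_sub hsa]; ring
    linear_combination Real.log m * e3
  rw [h1, Real.log_div (mul_ne_zero (hf _) (hf _)) (mul_ne_zero (hf _) (hf _)),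
    Real.log_mul (hf _) (hf _), Real.log_mul (hf _) (hf _), h2, coverError]
  have hmono : ∀ N : ℕ, N ≤ m → Real.log (N + 1) ≤ Real.log (m + 1) := fun N hN =>
    Real.log_le_log (by positivity) (by have : (N : ℝ) ≤ m := by exact_mod_cast hN
                                        linarith)
  have e3 : ((m - s : ℕ) : ℝ) + a - (a - s : ℕ) = m := by
    rw [Nat.cast_sub hsm, Nat.cast_sub hsa]; ring
  rw [abs_le]
  constructor <;>
    linarith [log_factorial_ge a, log_factorial_le a, log_factorial_ge (m - s),
      log_factorial_le (m - s), log_factorial_ge (a - s), log_factorial_le (a - s),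
      log_factorial_ge m, log_factorial_le m, hmono a ham, hmono (m - s) (Nat.sub_le _ _),
      hmono (a - s) ((Nat.sub_le _ _).trans ham)]

lemma coverRatio_le_exp {m s a : ℕ} (hm : 0 < m) (hsa : s ≤ a) (ham : a ≤ m) :
    coverRatio m s a ≤ Real.exp (-(m * coverExponent (s / m) (a / m)) + coverError m) := by
  have h := (abs_le.mp (abs_log_coverRatio_add_le hm hsa ham)).2
  have hpos : 0 < coverRatio m s a := by
    have h1 : (0 : ℝ) < a.choose s := by exact_mod_cast Nat.choose_pos hsa
    have h2 : (0 : ℝ) < m.choose s := by exact_mod_cast Nat.choose_pos (hsa.trans ham)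
    exact div_pos h1 h2
  rw [← Real.log_le_iff_le_exp hpos]
  linarith

lemma exp_le_coverRatio {m s a : ℕ} (hm : 0 < m) (hsa : s ≤ a) (ham : a ≤ m) :
    Real.exp (-(m * coverExponent (s / m) (a / m)) - coverError m) ≤ coverRatio m s a := by
  have h := (abs_le.mp (abs_log_coverRatio_add_le hm hsa ham)).1
  have hpos : 0 < coverRatio m s a := by
    have h1 : (0 : ℝ) < a.choose s := by exact_mod_cast Nat.choose_pos hsa
    have h2 : (0 : ℝ) < m.choose s := by exact_mod_cast Nat.choose_pos (hsa.trans ham)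
    exact div_pos h1 h2
  rw [← Real.le_log_iff_exp_le hpos]
  linarith

lemma continuous_coverExponent : Continuous fun p : ℝ × ℝ => coverExponent p.1 p.2 := by
  unfold coverExponent
  fun_prop

/-- By concavity of `-x log x`, covering becomes more likely as more tests are covered. -/
lemma coverExponent_anti {a b b' : ℝ} (ha : 0 ≤ a) (hab : a ≤ b) (hb : b ≤ b') :
    coverExponent a b' ≤ coverExponent a b := by
  rcases (show 0 ≤ b' - b + a by linarith).eq_or_lt with h0 | hL
  · have h1 : b' = b := by linarith
    rw [h1]
  -- Both `b` and `b' - a` are convex combinations of `b - a` and `b'`, with swapped weights.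
  have hx : b - a ∈ Set.Ici (0 : ℝ) := by simpa using hab
  have hy : b' ∈ Set.Ici (0 : ℝ) := by simpa using ha.trans (hab.trans hb)
  have h1 : 0 ≤ (b' - b) / (b' - b + a) := div_nonneg (by linarith) hL.le
  have h2 : 0 ≤ a / (b' - b + a) := div_nonneg ha hL.le
  have h3 : (b' - b) / (b' - b + a) + a / (b' - b + a) = 1 := by field_simp
  have c1 := Real.concaveOn_negMulLog.2 hx hy h1 h2 h3
  have c2 := Real.concaveOn_negMulLog.2 hx hy h2 h1 (by linarith)
  simp only [smul_eq_mul] at c1 c2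
  have e1 : (b' - b) / (b' - b + a) * (b - a) + a / (b' - b + a) * b' = b := by
    field_simp; ring
  have e2 : a / (b' - b + a) * (b - a) + (b' - b) / (b' - b + a) * b' = b' - a := by
    field_simp; ring
  rw [e1] at c1
  rw [e2] at c2
  have e3 : (b' - b) / (b' - b + a) * Real.negMulLog (b - a) +
      a / (b' - b + a) * Real.negMulLog (b - a) = Real.negMulLog (b - a) := by
    rw [← add_mul, h3, one_mul]
  have e4 : (b' - b) / (b' - b + a) * Real.negMulLog b' +
      a / (b' - b + a) * Real.negMulLog b' = Real.negMulLog b' := by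
    rw [← add_mul, h3, one_mul]
  unfold coverExponent
  linarith

/-! ### Optimal column weight -/

/-- The rate for columns of relative weight `a`, when `d` of them typically cover the proportion
`1 - (1 - a) ^ d` of the tests. -/
noncomputable def weightRate (d : ℕ) (a : ℝ) : ℝ := coverExponent a (1 - (1 - a) ^ d)

/-- The largest rate over all relative column weights. -/
noncomputable def maxRate (d : ℕ) : ℝ := sSup (weightRate d '' Set.Icc 0 1)

lemma continuous_weightRate (d : ℕ) : Continuous (weightRate d) := by
  unfold weightRate coverExponent
  fun_prop

lemma weightRate_le_maxRate (d : ℕ) {a : ℝ} (ha : a ∈ Set.Icc (0 : ℝ) 1) :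
    weightRate d a ≤ maxRate d :=
  le_csSup (isCompact_Icc.image (continuous_weightRate d)).bddAbove ⟨a, ha, rfl⟩

lemma le_one_sub_pow {d : ℕ} (hd : 1 ≤ d) {a : ℝ} (h0 : 0 ≤ a) (h1 : a ≤ 1) :
    a ≤ 1 - (1 - a) ^ d := by
  have : (1 - a) ^ d ≤ (1 - a) ^ 1 := pow_le_pow_of_le_one (by linarith) (by linarith) hd
  linarith [pow_one (1 - a)]

lemma sub_sq_le_coverExponent {a b : ℝ} (ha : 0 < a) (ha1 : a < 1) (hab : a ≤ b) :
    -(a * Real.log b) - a ^ 2 ≤ coverExponent a b := by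
  have h1 : a * (1 - a) ≤ Real.negMulLog (1 - a) := by
    have := Real.log_le_sub_one_of_pos (x := 1 - a) (by linarith)
    rw [Real.negMulLog]
    nlinarith
  have h2 : -(a * Real.log b) - a ≤ Real.negMulLog b - Real.negMulLog (b - a) := by
    rcases hab.eq_or_lt with rfl | hlt
    · simp [Real.negMulLog, ha.le]
    have h3 := Real.log_le_sub_one_of_pos (x := b / (b - a)) (div_pos (by linarith) (by linarith))
    rw [Real.log_div (by linarith) (by linarith)] at h3
    have h4 := mul_le_mul_of_nonneg_left h3 (show 0 ≤ b - a by linarith)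
    have h5 : (b - a) * (b / (b - a) - 1) = a := by
      have : b - a ≠ 0 := by linarith
      field_simp
      ring
    rw [h5] at h4
    simp only [Real.negMulLog]
    linarith
  unfold coverExponent
  linarith

lemma maxRate_pos {d : ℕ} (hd : 1 ≤ d) : 0 < maxRate d := by
  have hd' : (1 : ℝ) ≤ d := by exact_mod_cast hd
  -- For a small weight `a` the rate is at least `-a log (d a) - a ^ 2 > 0`.
  set a : ℝ := Real.exp (-2) / d with ha
  have he : Real.exp (-2) < 1 := by rw [Real.exp_lt_one_iff]; norm_num
  have ha0 : 0 < a := by positivity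
  have ha1 : a < 1 := by rw [ha, div_lt_one (by linarith)]; linarith
  have hb : 1 - (1 - a) ^ d ≤ Real.exp (-2) := by
    have h := one_add_mul_le_pow (a := -a) (by linarith) d
    have : (d : ℝ) * a = Real.exp (-2) := by rw [ha]; field_simp
    rw [← sub_eq_add_neg] at h
    linarith
  have hab := le_one_sub_pow hd ha0.le ha1.le
  have hlog : Real.log (1 - (1 - a) ^ d) ≤ -2 := by
    rw [Real.log_le_iff_le_exp (by linarith)]
    exact hb
  have h1 := sub_sq_le_coverExponent ha0 ha1 hab
  have h2 := weightRate_le_maxRate d ⟨ha0.le, ha1.le⟩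
  rw [weightRate] at h2
  nlinarith

lemma exists_weightRate_eq_maxRate {d : ℕ} (hd : 1 ≤ d) :
    ∃ a ∈ Set.Ioc (0 : ℝ) 1, weightRate d a = maxRate d := by
  obtain ⟨a, ha, h⟩ := (isCompact_Icc.image (continuous_weightRate d)).sSup_mem
    ((Set.nonempty_Icc.mpr zero_le_one).image _)
  refine ⟨a, ⟨ha.1.lt_of_ne ?_, ha.2⟩, h⟩
  rintro rfl
  have h0 : weightRate d 0 = 0 := by simp [weightRate, coverExponent]
  have := maxRate_pos hd
  rw [maxRate, ← h, h0] at this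
  exact this.false

/-- The rate of the random set design in bits is `weightRate` in other units. -/
lemma log_two_mul_rssdRate {d : ℕ} (hd : 1 ≤ d) {x : ℝ} (hx : x ∈ Set.Ioc 0 (d : ℝ)) :
    Real.log 2 * rssdRate d x = weightRate d (x / d) := by
  have hd' : (0 : ℝ) < d := by exact_mod_cast hd
  have hl : Real.log 2 ≠ 0 := (Real.log_pos one_lt_two).ne'
  have hent : ∀ p, Real.log 2 * entropyBits p = Real.negMulLog p + Real.negMulLog (1 - p) := by
    intro p
    simp only [entropyBits, Real.logb, Real.negMulLog]
    field_simp
    ring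
  have ha0 : 0 < x / d := div_pos hx.1 hd'
  have ha1 : x / d ≤ 1 := (div_le_one hd').mpr hx.2
  have hab := le_one_sub_pow hd ha0.le ha1
  have hb : 0 < 1 - (1 - x / d) ^ d := ha0.trans_le hab
  simp only [rssdRate, weightRate, coverExponent]
  set a := x / d
  set b := 1 - (1 - a) ^ d
  have e1 : 1 - a / b = (b - a) / b := by field_simp
  rw [mul_sub, hent, mul_left_comm, hent, e1, mul_add, mul_negMulLog_div hb, mul_negMulLog_div hb]
  simp only [Real.negMulLog]
  ring

lemma isGreatest_rssdRate {d : ℕ} (hd : 1 ≤ d) :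
    IsGreatest (rssdRate d '' Set.Ioc 0 (d : ℝ)) (maxRate d / Real.log 2) := by
  have hd' : (0 : ℝ) < d := by exact_mod_cast hd
  have hl : 0 < Real.log 2 := Real.log_pos one_lt_two
  constructor
  · obtain ⟨a, ha, h⟩ := exists_weightRate_eq_maxRate hd
    have hx : d * a ∈ Set.Ioc 0 (d : ℝ) :=
      ⟨mul_pos hd' ha.1, mul_le_of_le_one_right hd'.le ha.2⟩
    refine ⟨d * a, hx, ?_⟩
    rw [eq_div_iff hl.ne', mul_comm, log_two_mul_rssdRate hd hx, mul_div_cancel_left₀ _ hd'.ne', h]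
  · rintro _ ⟨x, hx, rfl⟩
    rw [le_div_iff₀ hl, mul_comm, log_two_mul_rssdRate hd hx]
    exact weightRate_le_maxRate d ⟨(div_pos hx.1 hd').le, (div_le_one hd').mpr hx.2⟩

/-! ### Asymptotics of the optimal rate -/

lemma mul_log_le_mul_log_one_sub {u : ℝ} (h0 : 0 < u) (h1 : u ≤ 1 / 2) :
    u * Real.log u ≤ (1 - u) * Real.log (1 - u) := by
  -- `1 - u` is the convex combination of `u` and `1` with weight `u / (1 - u)` on `u`.
  have hq : 0 < 1 - u := by linarith
  have hw : u / (1 - u) ≤ 1 := by rw [div_le_one hq]; linarith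
  have h := strictConcaveOn_log_Ioi.concaveOn.2 (Set.mem_Ioi.mpr h0)
    (Set.mem_Ioi.mpr one_pos) (div_pos h0 hq).le (sub_nonneg.mpr hw) (by ring)
  simp only [smul_eq_mul, Real.log_one, mul_zero, add_zero] at h
  rw [show u / (1 - u) * u + (1 - u / (1 - u)) * 1 = 1 - u by field_simp; ring,
    div_mul_eq_mul_div, div_le_iff₀ hq] at h
  linarith

/-- The product `log u * log (1 - u)` is largest at `u = 1 / 2`. -/
lemma log_mul_log_one_sub_le {u : ℝ} (h0 : 0 < u) (h1 : u < 1) :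
    Real.log u * Real.log (1 - u) ≤ Real.log 2 ^ 2 := by
  wlog h : u ≤ 1 / 2 generalizing u
  · have := this (u := 1 - u) (by linarith) (by linarith) (by linarith)
    rwa [sub_sub_cancel, mul_comm] at this
  have hder : ∀ x ∈ Set.Ioc (0 : ℝ) (1 / 2), HasDerivAt (fun x => Real.log x * Real.log (1 - x))
      (x⁻¹ * Real.log (1 - x) + Real.log x * (-1 / (1 - x))) x := by
    intro x hx
    have hx2 := hx.2
    exact (Real.hasDerivAt_log hx.1.ne').mul
      (((hasDerivAt_id x).const_sub 1).log (by simp only [id]; linarith))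
  have hmono : MonotoneOn (fun x => Real.log x * Real.log (1 - x)) (Set.Ioc (0 : ℝ) (1 / 2)) := by
    refine monotoneOn_of_deriv_nonneg (convex_Ioc _ _)
      (fun x hx => (hder x hx).continuousAt.continuousWithinAt) ?_ ?_
    · intro x hx
      exact (hder x (interior_subset hx)).differentiableAt.differentiableWithinAt
    · intro x hx
      have hx := interior_subset hx
      have hx2 := hx.2
      have hq : 0 < 1 - x := by linarith
      have hx1 := hx.1
      rw [(hder x hx).deriv]
      have h := mul_log_le_mul_log_one_sub hx.1 hx.2
      have : x⁻¹ * Real.log (1 - x) + Real.log x * (-1 / (1 - x)) =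
          ((1 - x) * Real.log (1 - x) - x * Real.log x) / (x * (1 - x)) := by
        field_simp
        ring
      rw [this]
      exact div_nonneg (by linarith) (by positivity)
  have h2 := hmono ⟨h0, h⟩ (Set.right_mem_Ioc.mpr (by norm_num)) h
  refine h2.trans_eq ?_
  norm_num
  rw [one_div, Real.log_inv]
  ring

/-- Uniformly in the relative weight `a`, the rate is at most `-a log (1 - (1 - a) ^ d)` up to
`O(1 / d ^ 2)`, and `d a ≤ -log ((1 - a) ^ d)` reduces this to `log_mul_log_one_sub_le`. -/
lemma weightRate_le {d : ℕ} (hd : 2 ≤ d) {a : ℝ} (ha : a ∈ Set.Icc (0 : ℝ) 1) :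
    weightRate d a ≤ Real.log 2 ^ 2 / d + 9 / (d : ℝ) ^ 2 := by
  obtain ⟨h0, h1⟩ := ha
  have hd' : (2 : ℝ) ≤ d := by exact_mod_cast hd
  have hnn : 0 ≤ Real.log 2 ^ 2 / d + 9 / (d : ℝ) ^ 2 := by positivity
  rcases h0.eq_or_lt with rfl | h0
  · simpa [weightRate, coverExponent] using hnn
  rcases h1.eq_or_lt with rfl | h1
  · simpa [weightRate, coverExponent, show d ≠ 0 by omega] using hnn
  obtain ⟨k, rfl⟩ : ∃ k, d = k + 1 := ⟨d - 1, by omega⟩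
  set D : ℝ := ((k + 1 : ℕ) : ℝ) with hD
  have hDk : D = k + 1 := by rw [hD]; push_cast; ring
  set q : ℝ := 1 - a with hq
  have hq0 : 0 < q := by linarith
  have hq1 : q < 1 := by linarith
  set Q : ℝ := q ^ k with hQ
  have hQ0 : 0 < Q := by positivity
  have hQ1 : Q < 1 := pow_lt_one₀ hq0.le hq1 (by omega)
  have hqQ : q ^ (k + 1) = q * Q := by rw [pow_succ, mul_comm]
  set b : ℝ := 1 - q * Q with hb
  have hb0 : 0 < b := by nlinarith
  have hb1 : b ≤ 1 := by nlinarith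
  have hba : b - a = q * (1 - Q) := by rw [hb, hq]; ring
  -- Expand the rate with `log (b - a) = log q + log (1 - Q)`.
  have hexp : weightRate (k + 1) a = -(a * Real.log b) + q * Q * (-Real.log q) +
      q * (1 - Q) * (Real.log (1 - Q) - Real.log b) := by
    rw [weightRate, coverExponent, ← hq, hqQ, ← hb, hba]
    simp only [Real.negMulLog]
    rw [Real.log_mul hq0.ne' (by linarith)]
    have : a = 1 - q := by rw [hq]; ring
    rw [this, hb]
    ring
  have hlv : Real.log (1 - Q) - Real.log b ≤ -(a * Q / b) := by
    rw [← Real.log_div (by linarith) hb0.ne']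
    refine (Real.log_le_sub_one_of_pos (div_pos (by linarith) hb0)).trans_eq ?_
    field_simp
    rw [hb, hq]; ring
  have hlq : q * (-Real.log q) ≤ a := by
    have := Real.one_sub_inv_le_log_of_pos hq0
    have h2 := mul_le_mul_of_nonneg_left this hq0.le
    rw [mul_sub, mul_inv_cancel₀ hq0.ne'] at h2
    linarith
  have hbD : D * a * Q ≤ b := by
    have hsum : D * Q ≤ ∑ i ∈ Finset.range (k + 1), q ^ i := by
      calc D * Q = ∑ _i ∈ Finset.range (k + 1), Q := by simp [hD]
        _ ≤ _ := Finset.sum_le_sum fun i hi =>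
          pow_le_pow_of_le_one hq0.le hq1.le (by have := Finset.mem_range.mp hi; omega)
    have hg : b = a * ∑ i ∈ Finset.range (k + 1), q ^ i := by
      have := mul_neg_geom_sum q (k + 1)
      rw [hqQ] at this
      rw [hb, ← this, hq]; ring
    rw [hg]
    nlinarith
  have haQ : a * Q ≤ 1 / D := by
    rw [le_div_iff₀ (by linarith)]; linarith
  have t1 : -(a * Real.log b) ≤ Real.log 2 ^ 2 / D := by
    have h := log_mul_log_one_sub_le (u := q * Q) (by positivity) (by linarith)
    rw [← hqQ, Real.log_pow, hqQ, ← hb, ← hD] at h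
    have hlogb : Real.log b ≤ 0 := Real.log_nonpos hb0.le hb1
    have hlogq : a ≤ -Real.log q := by linarith [Real.log_le_sub_one_of_pos hq0]
    rw [le_div_iff₀ (by linarith)]
    nlinarith [mul_le_mul_of_nonneg_left hlogq
      (mul_nonneg (show 0 ≤ D by linarith) (neg_nonneg.mpr hlogb))]
  have t2 : q * Q * (-Real.log q) ≤ q * Q * a + a ^ 2 * Q := by
    have := mul_le_mul_of_nonneg_left hlq hQ0.le
    have e : q = 1 - a := hq
    nlinarith
  have t3 : q * (1 - Q) * (Real.log (1 - Q) - Real.log b) ≤ -(q * Q * a) + a * Q * (1 / D) := by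
    have h := mul_le_mul_of_nonneg_left hlv
      (show 0 ≤ q * (1 - Q) from mul_nonneg hq0.le (by linarith))
    have e : q * (1 - Q) * -(a * Q / b) = -(q * Q * a) + q * (a * Q) * (a * Q / b) := by
      have : 1 - Q = b - a * Q := by rw [hb, hq]; ring
      rw [this]
      field_simp
      ring
    have h2 : a * Q / b ≤ 1 / D := by
      rw [div_le_div_iff₀ hb0 (by linarith)]; linarith
    have h3 : q * (a * Q) * (a * Q / b) ≤ 1 * (a * Q) * (1 / D) := by
      gcongr
    linarith
  have t4 : a ^ 2 * Q ≤ 8 / D ^ 2 := by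
    -- `Q ≤ exp (-k a)` and `t ^ 2 / 2 ≤ exp t` for `t = k a`.
    have hQe : Q * Real.exp (k * a) ≤ 1 := by
      have h := Real.add_one_le_exp (-a)
      have h2 : Q ≤ Real.exp (-a) ^ k := pow_le_pow_left₀ hq0.le (by linarith) k
      rw [← Real.exp_nat_mul] at h2
      calc Q * Real.exp (k * a) ≤ Real.exp (k * -a) * Real.exp (k * a) := by gcongr
        _ = 1 := by rw [← Real.exp_add]; simp
    have h3 := Real.quadratic_le_exp_of_nonneg (x := k * a) (by positivity)
    have h4 : Q * ((k * a) ^ 2 / 2) ≤ 1 := by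
      refine le_trans (mul_le_mul_of_nonneg_left ?_ hQ0.le) hQe
      have : (0 : ℝ) ≤ k * a := by positivity
      linarith
    have h5 : D ≤ 2 * k := by linarith
    rw [le_div_iff₀ (by positivity)]
    calc a ^ 2 * Q * D ^ 2 ≤ a ^ 2 * Q * (2 * k) ^ 2 := by gcongr
      _ = 8 * (Q * ((k * a) ^ 2 / 2)) := by ring
      _ ≤ 8 := by linarith
  have t5 : a * Q * (1 / D) ≤ 1 / D ^ 2 := by
    calc a * Q * (1 / D) ≤ 1 / D * (1 / D) := by gcongr
      _ = 1 / D ^ 2 := by ring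
  have t6 : 9 / D ^ 2 = 8 / D ^ 2 + 1 / D ^ 2 := by ring
  linarith

/-- The optimal relative column weight is about `log 2 / d`. -/
lemma tendsto_mul_maxRate :
    Tendsto (fun d : ℕ => d * maxRate d) atTop (𝓝 (Real.log 2 ^ 2)) := by
  have hl0 : 0 < Real.log 2 := Real.log_pos one_lt_two
  have hl1 : Real.log 2 < 1 := by linarith [Real.log_two_lt_d9]
  have hcast : Tendsto (fun d : ℕ => (d : ℝ)) atTop atTop := tendsto_natCast_atTop_atTop
  have hlow : Tendsto (fun d : ℕ => -(Real.log 2 * Real.log (1 - (1 - Real.log 2 / d) ^ d)) -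
      Real.log 2 ^ 2 / d) atTop (𝓝 (Real.log 2 ^ 2)) := by
    have h1 : Tendsto (fun d : ℕ => (1 - Real.log 2 / d) ^ d) atTop (𝓝 (1 / 2)) := by
      have := Real.tendsto_one_add_div_pow_exp (-Real.log 2)
      rw [Real.exp_neg, Real.exp_log two_pos] at this
      simpa [neg_div, ← sub_eq_add_neg] using this
    have h2 : Tendsto (fun d : ℕ => Real.log 2 ^ 2 / (d : ℝ)) atTop (𝓝 0) :=
      tendsto_const_nhds.div_atTop hcast
    have h3 := (((tendsto_const_nhds (x := (1 : ℝ))).sub h1).log (by norm_num)).const_mul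
      (Real.log 2) |>.neg.sub h2
    convert! h3 using 2
    norm_num
    rw [one_div, Real.log_inv]
    ring
  have hup : Tendsto (fun d : ℕ => Real.log 2 ^ 2 + 9 / (d : ℝ)) atTop (𝓝 (Real.log 2 ^ 2)) := by
    simpa using (tendsto_const_nhds (x := Real.log 2 ^ 2)).add
      ((tendsto_const_nhds (x := (9 : ℝ))).div_atTop hcast)
  refine tendsto_of_tendsto_of_tendsto_of_le_of_le' hlow hup ?_ ?_
  · filter_upwards [eventually_ge_atTop 1] with d hd
    have hd' : (1 : ℝ) ≤ d := by exact_mod_cast hd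
    have ha0 : 0 < Real.log 2 / d := by positivity
    have ha1 : Real.log 2 / d < 1 := by rw [div_lt_one (by linarith)]; linarith
    have h1 := sub_sq_le_coverExponent ha0 ha1 (le_one_sub_pow hd ha0.le ha1.le)
    have h2 := h1.trans (weightRate_le_maxRate d ⟨ha0.le, ha1.le⟩)
    have h3 := mul_le_mul_of_nonneg_left h2 (show (0 : ℝ) ≤ d by linarith)
    refine le_of_eq_of_le ?_ h3
    field_simp
  · filter_upwards [eventually_ge_atTop 2] with d hd
    have hd' : (2 : ℝ) ≤ d := by exact_mod_cast hd
    have h : maxRate d ≤ Real.log 2 ^ 2 / d + 9 / (d : ℝ) ^ 2 := by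
      refine csSup_le ((Set.nonempty_Icc.mpr zero_le_one).image _) ?_
      rintro _ ⟨a, ha, rfl⟩
      exact weightRate_le hd ha
    have h3 := mul_le_mul_of_nonneg_left h (show (0 : ℝ) ≤ d by linarith)
    refine h3.trans_eq ?_
    field_simp

/-! ### Disjunctness and separability -/

section Deterministic

variable {m n : ℕ}

lemma answers_eq_true_iff (C : Fin n → Fin m → Bool) (I : Finset (Fin n)) (t : Fin m) :
    answers (Matrix.of C).transpose I t = true ↔ t ∈ coveredTests C I := by
  simp only [answers, coveredTests, Matrix.transpose_apply, Matrix.of_apply, Finset.mem_filter,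
    Finset.mem_univ, true_and]
  induction I using Finset.induction_on with
  | empty => simp
  | insert i I _ ih => simp [Finset.sup_insert, ih]

/-- No column, inside or outside `I`, is covered by the other columns of `I`. -/
def IsIrredundantFor (C : Fin n → Fin m → Bool) (I : Finset (Fin n)) : Prop :=
  ∀ i, ¬ ∀ t, C i t = true → t ∈ coveredTests C (I.erase i)

lemma IsIrredundantFor.isDisjunctFor {C : Fin n → Fin m → Bool} {I : Finset (Fin n)}
    (h : IsIrredundantFor C I) : IsDisjunctFor (Matrix.of C).transpose I := by
  rw [isDisjunctFor_iff]
  intro i hi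
  have := h i
  rwa [Finset.erase_eq_of_notMem (Finset.mem_compl.mp hi)] at this

lemma IsIrredundantFor.isSeparableFor {C : Fin n → Fin m → Bool} {I : Finset (Fin n)}
    (h : IsIrredundantFor C I) (d : ℕ) : IsSeparableFor d (Matrix.of C).transpose I := by
  intro J _ hne heq
  have hcov : coveredTests C J = coveredTests C I := by
    ext t
    rw [← answers_eq_true_iff, heq, answers_eq_true_iff]
  have hmem : ∀ {K : Finset (Fin n)} {i t}, i ∈ K → C i t = true → t ∈ coveredTests C K := by
    intro K i t hi ht
    simp only [coveredTests, Finset.mem_filter, Finset.mem_univ, true_and]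
    exact ⟨i, hi, ht⟩
  by_cases hJ : J ⊆ I
  · obtain ⟨i, hi, hiJ⟩ := Finset.exists_of_ssubset (Finset.ssubset_iff_subset_ne.mpr ⟨hJ, hne⟩)
    refine h i fun t ht => ?_
    have h1 : t ∈ coveredTests C J := hcov ▸ hmem hi ht
    simp only [coveredTests, Finset.mem_filter, Finset.mem_univ, true_and] at h1
    obtain ⟨j, hj, hjt⟩ := h1
    exact hmem (Finset.mem_erase.mpr ⟨fun e => hiJ (e ▸ hj), hJ hj⟩) hjt
  · obtain ⟨i, hi, hiI⟩ := Finset.not_subset.mp hJ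
    refine h i fun t ht => ?_
    rw [Finset.erase_eq_of_notMem hiI, ← hcov]
    exact hmem hi ht

/-- If fewer than `d` items are defective, separability forces disjunctness: a covered item could
be added to the defective ones. -/
lemma IsSeparableFor.isDisjunctFor {C : Fin n → Fin m → Bool} {I : Finset (Fin n)} {d : ℕ}
    (hI : I.card < d) (h : IsSeparableFor d (Matrix.of C).transpose I) :
    IsDisjunctFor (Matrix.of C).transpose I := by
  rw [isDisjunctFor_iff]
  intro i hi hcov
  rw [Finset.mem_compl] at hi
  refine h (insert i I) ((Finset.card_insert_le _ _).trans hI)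
    (fun e => hi (e ▸ Finset.mem_insert_self i I)) ?_
  ext t
  rw [Bool.eq_iff_iff, answers_eq_true_iff, answers_eq_true_iff]
  have := hcov t
  simp only [coveredTests, Finset.mem_filter, Finset.mem_univ, true_and, Finset.mem_insert,
    exists_eq_or_imp] at this ⊢
  tauto

lemma rssdProb_mono {s : ℕ} {P Q : Matrix (Fin m) (Fin n) Bool → Prop}
    (h : ∀ C : Fin n → Fin m → Bool, P (Matrix.of C).transpose → Q (Matrix.of C).transpose) :
    rssdProb m n s P ≤ rssdProb m n s Q := by
  classical
  rw [rssdProb_eq_prodMean, rssdProb_eq_prodMean]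
  refine prodMean_mono (columnWeight_nonneg m s) fun C _ => ?_
  have := h C
  split_ifs <;> first | tauto | norm_num

end Deterministic

/-! ### Thresholds for the number of tests -/

lemma tendsto_mul_sub_coverError {c : ℝ} (hc : 0 < c) :
    Tendsto (fun m : ℕ => c * m - coverError m) atTop atTop := by
  have hcast : Tendsto (fun m : ℕ => (m : ℝ)) atTop atTop := tendsto_natCast_atTop_atTop
  have h1 := (Real.isLittleO_log_id_atTop.comp_tendsto
    (tendsto_atTop_add_const_right atTop (1 : ℝ) hcast)).def (show 0 < c / 4 by positivity)
  refine tendsto_atTop_mono' _ ?_ (tendsto_atTop_add_const_right atTop (-(c / 2 + 2))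
    (hcast.const_mul_atTop (show 0 < c / 2 by positivity)))
  filter_upwards [h1] with m hm
  simp only [Function.comp, id, Real.norm_eq_abs] at hm
  rw [abs_of_pos (show (0 : ℝ) < m + 1 by positivity)] at hm
  have := le_abs_self (Real.log (m + 1))
  unfold coverError
  linarith

lemma coverError_nonneg (m : ℕ) : 0 ≤ coverError m := by
  have : 0 ≤ Real.log ((m : ℝ) + 1) := Real.log_nonneg (by linarith [Nat.cast_nonneg (α := ℝ) m])
  unfold coverError
  linarith

lemma exists_uniform_coverExponent {γ : ℝ} (hγ : 0 < γ) :
    ∃ ε > 0, ∀ a ∈ Set.Icc (0 : ℝ) 1, ∀ b ∈ Set.Icc (0 : ℝ) 1, ∀ b' ∈ Set.Icc (0 : ℝ) 1,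
      |b - b'| < ε → |coverExponent a b - coverExponent a b'| < γ := by
  have h := (isCompact_Icc (a := (0 : ℝ)) (b := 1)).prod (isCompact_Icc (a := (0 : ℝ)) (b := 1))
    |>.uniformContinuousOn_of_continuous continuous_coverExponent.continuousOn
  obtain ⟨ε, hε, h⟩ := Metric.uniformContinuousOn_iff.mp h γ hγ
  refine ⟨ε, hε, fun a ha b hb b' hb' hbb => ?_⟩
  have := h (a, b) ⟨ha, hb⟩ (a, b') ⟨ha, hb'⟩ (by
    rw [Prod.dist_eq]
    simpa [Real.dist_eq] using hbb)
  simpa [Real.dist_eq] using this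

lemma one_sub_pow_mem_Icc {a : ℝ} (ha : a ∈ Set.Icc (0 : ℝ) 1) (d : ℕ) :
    1 - (1 - a) ^ d ∈ Set.Icc (0 : ℝ) 1 := by
  have h1 := pow_nonneg (sub_nonneg.mpr ha.2) d
  have h2 := pow_le_one₀ (n := d) (sub_nonneg.mpr ha.2) (by linarith [ha.1])
  exact ⟨by linarith, by linarith⟩

lemma natCast_div_mem_Icc {a m : ℕ} (h : a ≤ m) : (a : ℝ) / m ∈ Set.Icc (0 : ℝ) 1 :=
  ⟨by positivity, div_le_one_of_le₀ (by exact_mod_cast h) (by positivity)⟩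

/-- Failure of irredundancy is bounded by the union bound over the columns outside `I` and, for
each column in `I`, by its chance to be covered by the others. -/
lemma one_sub_le_rssdProb_isIrredundantFor {m n d s : ℕ} (hm : 0 < m) (hn : 1 ≤ n) (hs : s ≤ m)
    {ε B : ℝ} (hε : 0 < ε) (hB : 0 ≤ B)
    (h : ∀ k ≤ d, ∀ a ≤ m, |(a : ℝ) / m - (1 - (1 - (s : ℝ) / m) ^ k)| < ε → coverRatio m s a ≤ B)
    (I : Finset (Fin n)) (hI : I.card ≤ d) :
    1 - (d + 1) * (1 / (ε ^ 2 * m) + n * B) ≤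
      rssdProb m n s (fun M => IsIrredundantFor M.transpose I) := by
  classical
  have hn' : (1 : ℝ) ≤ n := by exact_mod_cast hn
  set e : ℝ := 1 / (ε ^ 2 * m) with he
  have he0 : 0 ≤ e := by positivity
  let bad : Finset (Fin n) → Finset (Fin n) → (Fin n → Fin m → Bool) → ℝ := fun K S C =>
    if ∃ i ∈ S, ∀ t, C i t = true → t ∈ coveredTests C K then 1 else 0
  have hbad0 : ∀ K S C, 0 ≤ bad K S C := by
    intro K S C
    simp only [bad]
    split_ifs <;> norm_num
  have hbad : ∀ K S : Finset (Fin n), K.card ≤ d → Disjoint S K →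
      prodMean (columnWeight m s) (bad K S) ≤ e + S.card * B := fun K S hK hSK =>
    prodMean_exists_contained_le hm hs K S hSK hε hB (h K.card hK)
  have hkey : 1 ≤ rssdProb m n s (fun M => IsIrredundantFor M.transpose I) +
      (prodMean (columnWeight m s) (bad I Iᶜ) +
        ∑ i ∈ I, prodMean (columnWeight m s) (bad (I.erase i) {i})) := by
    rw [rssdProb_eq_prodMean, ← prodMean_sum, ← prodMean_add, ← prodMean_add]
    refine le_of_eq_of_le (prodMean_const (ι := Fin n) (sum_columnWeight hs) 1).symm ?_
    refine prodMean_mono (columnWeight_nonneg m s) fun C _ => ?_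
    have hsum : 0 ≤ ∑ i ∈ I, bad (I.erase i) {i} C := Finset.sum_nonneg fun i _ => hbad0 _ _ _
    rw [Matrix.transpose_transpose]
    split_ifs with hC
    · linarith [hbad0 I Iᶜ C]
    · unfold IsIrredundantFor at hC
      push Not at hC
      obtain ⟨i, hi⟩ := hC
      by_cases hiI : i ∈ I
      · have h1 := Finset.single_le_sum (f := fun i => bad (I.erase i) {i} C)
          (fun i _ => hbad0 _ _ _) hiI
        have h2 : bad (I.erase i) {i} C = 1 := if_pos ⟨i, Finset.mem_singleton_self i, hi⟩
        simp only [h2] at h1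
        linarith [hbad0 I Iᶜ C]
      · rw [Finset.erase_eq_of_notMem hiI] at hi
        have h2 : bad I Iᶜ C = 1 := if_pos ⟨i, Finset.mem_compl.mpr hiI, hi⟩
        linarith
  have h1 := hbad I Iᶜ hI disjoint_compl_left
  have h2 : ∑ i ∈ I, prodMean (columnWeight m s) (bad (I.erase i) {i}) ≤ d * (e + n * B) := by
    calc _ ≤ ∑ i ∈ I, (e + n * B) := by
          refine Finset.sum_le_sum fun i hi => ?_
          have := hbad (I.erase i) {i} ((Finset.card_le_card (Finset.erase_subset _ _)).trans hI)
            (by simp)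
          rw [Finset.card_singleton, Nat.cast_one, one_mul] at this
          nlinarith
      _ ≤ d * (e + n * B) := by
          rw [Finset.sum_const, nsmul_eq_mul]
          have : (I.card : ℝ) ≤ d := by exact_mod_cast hI
          gcongr
  have h3 : ((Iᶜ : Finset (Fin n)).card : ℝ) * B ≤ n * B := by
    have : (Iᶜ : Finset (Fin n)).card ≤ n := by simpa using Finset.card_le_univ Iᶜ
    have : ((Iᶜ : Finset (Fin n)).card : ℝ) ≤ n := by exact_mod_cast this
    gcongr
  linarith

/-- With more than `ln n / maxRate d` tests, the optimal column weight makes `I` irredundant. -/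
lemma eventually_exists_isIrredundantFor {d : ℕ} (hd : 1 ≤ d) {δ κ : ℝ} (hδ : 0 < δ)
    (hκ : 1 / maxRate d < κ) :
    ∀ᶠ n : ℕ in atTop, ∃ m s : ℕ, (m : ℝ) ≤ κ * Real.log n ∧ s ≤ m ∧
      ∀ I : Finset (Fin n), I.card ≤ d →
        1 - δ ≤ rssdProb m n s (fun M => IsIrredundantFor M.transpose I) := by
  set G := maxRate d with hG
  have hG0 : 0 < G := maxRate_pos hd
  obtain ⟨κ₁, hκ₁, hκ₁κ⟩ := exists_between hκ
  have hκ₁0 : 0 < κ₁ := (by positivity : 0 < 1 / G).trans hκ₁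
  set γ := (G - 1 / κ₁) / 4 with hγ
  have hγ0 : 0 < γ := by
    have : 1 / κ₁ < G := by rwa [div_lt_comm₀ hκ₁0 hG0]
    rw [hγ]; linarith
  obtain ⟨ε, hε, hunif⟩ := exists_uniform_coverExponent hγ0
  obtain ⟨x, hx, hxG⟩ := exists_weightRate_eq_maxRate hd
  have hcast : Tendsto (fun m : ℕ => (m : ℝ)) atTop atTop := tendsto_natCast_atTop_atTop
  have hrate : ∀ᶠ m : ℕ in atTop, G - γ < weightRate d ((⌊x * m⌋₊ : ℝ) / m) := by
    have h1 : Tendsto (fun m : ℕ => (⌊x * m⌋₊ : ℝ) / m) atTop (𝓝 x) :=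
      (tendsto_nat_floor_mul_div_atTop hx.1.le).comp hcast
    have h2 := ((continuous_weightRate d).tendsto x).comp h1
    exact h2.eventually_const_lt (by rw [hxG]; linarith)
  have hfail : ∀ᶠ m : ℕ in atTop, ((d : ℝ) + 1) * (1 / (ε ^ 2 * m) +
      Real.exp (-(2 * γ * m - coverError m))) < δ := by
    have h1 : Tendsto (fun m : ℕ => 1 / (ε ^ 2 * (m : ℝ))) atTop (𝓝 0) :=
      tendsto_const_nhds.div_atTop (hcast.const_mul_atTop (by positivity))
    have h2 := Real.tendsto_exp_neg_atTop_nhds_zero.comp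
      (tendsto_mul_sub_coverError (show 0 < 2 * γ by positivity))
    have h3 := (h1.add h2).const_mul ((d : ℝ) + 1)
    rw [add_zero, mul_zero] at h3
    exact h3.eventually_lt_const hδ
  have hlog : Tendsto (fun n : ℕ => Real.log n) atTop atTop := Real.tendsto_log_atTop.comp hcast
  have hm : Tendsto (fun n : ℕ => ⌈κ₁ * Real.log n⌉₊) atTop atTop :=
    tendsto_nat_ceil_atTop.comp (hlog.const_mul_atTop hκ₁0)
  filter_upwards [hm.eventually hrate, hm.eventually hfail, hm.eventually_ge_atTop 1,
    eventually_ge_atTop 1, (hlog.const_mul_atTop (sub_pos.mpr hκ₁κ)).eventually_ge_atTop 1]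
    with n hn1 hn2 hm1 hn hn3
  set m := ⌈κ₁ * Real.log n⌉₊ with hmdef
  have hn' : (1 : ℝ) ≤ n := by exact_mod_cast hn
  have hlogn : 0 ≤ Real.log n := Real.log_nonneg hn'
  have hm0 : (0 : ℝ) < m := by exact_mod_cast hm1
  have hmle : (m : ℝ) < κ₁ * Real.log n + 1 := Nat.ceil_lt_add_one (by positivity)
  have hmge : κ₁ * Real.log n ≤ m := Nat.le_ceil _
  set s := ⌊x * m⌋₊ with hs
  have hsm : s ≤ m := by
    rw [hs]
    exact Nat.floor_le_of_le (mul_le_of_le_one_left hm0.le hx.2)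
  refine ⟨m, s, by linarith, hsm, fun I hI => ?_⟩
  set B := Real.exp (-(m * (G - 2 * γ)) + coverError m) with hB
  have hsI := natCast_div_mem_Icc hsm
  have hcover : ∀ k ≤ d, ∀ a ≤ m, |(a : ℝ) / m - (1 - (1 - (s : ℝ) / m) ^ k)| < ε →
      coverRatio m s a ≤ B := by
    intro k hk a ham ha
    rcases lt_or_ge a s with hlt | hsa
    · rw [coverRatio, Nat.choose_eq_zero_of_lt hlt]
      simp only [Nat.cast_zero, zero_div]
      positivity
    have haI := natCast_div_mem_Icc ham
    have hβ := one_sub_pow_mem_Icc hsI d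
    have hpow : (1 - (s : ℝ) / m) ^ d ≤ (1 - (s : ℝ) / m) ^ k :=
      pow_le_pow_of_le_one (by linarith [hsI.2]) (by linarith [hsI.1]) hk
    -- Fewer than `d` defective items only decrease the number of covered tests, so that `a` is
    -- compared with `d` items from above.
    set b := max ((a : ℝ) / m) (1 - (1 - (s : ℝ) / m) ^ d) with hb
    have h1 : coverExponent (s / m) b ≤ coverExponent (s / m) (a / m) :=
      coverExponent_anti hsI.1 (by gcongr) (le_max_left _ _)
    have h2 : |b - (1 - (1 - (s : ℝ) / m) ^ d)| < ε := by
      rw [abs_of_nonneg (sub_nonneg.mpr (le_max_right _ _)), sub_lt_iff_lt_add, hb, max_lt_iff]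
      exact ⟨by linarith [(abs_lt.mp ha).2], by linarith⟩
    have h3 := (abs_lt.mp (hunif _ hsI b ⟨haI.1.trans (le_max_left _ _), max_le haI.2 hβ.2⟩ _ hβ
      h2)).1
    have h4 : G - 2 * γ ≤ coverExponent (s / m) (a / m) := by
      rw [weightRate] at hn1
      linarith
    refine (coverRatio_le_exp hm1 hsa ham).trans ?_
    rw [hB]
    gcongr
  have h := one_sub_le_rssdProb_isIrredundantFor hm1 hn hsm hε (Real.exp_pos _).le hcover I hI
  refine le_trans ?_ h
  have hnB : n * B ≤ Real.exp (-(2 * γ * m - coverError m)) := by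
    have h1 : (n : ℝ) ≤ Real.exp (m / κ₁) := by
      rw [← Real.log_le_iff_le_exp (by linarith), le_div_iff₀ hκ₁0]
      linarith
    calc n * B ≤ Real.exp (m / κ₁) * B := by gcongr
      _ = Real.exp (-(2 * γ * m - coverError m)) := by
        rw [hB, ← Real.exp_add, hγ]
        congr 1
        ring
  have : ((d : ℝ) + 1) * (1 / (ε ^ 2 * m) + n * B) ≤ ((d : ℝ) + 1) * (1 / (ε ^ 2 * m) +
      Real.exp (-(2 * γ * m - coverError m))) := by gcongr
  linarith

/-- With fewer than `ln n / maxRate d` tests, no column weight gives disjunctness. -/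
lemma eventually_le_of_isDisjunctFor {d : ℕ} (hd : 1 ≤ d) {δ κ : ℝ} (hδ : δ < 1)
    (hκ0 : 0 < κ) (hκ : κ < 1 / maxRate d) :
    ∀ᶠ n : ℕ in atTop, ∀ m s : ℕ, s ≤ m → ∀ I : Finset (Fin n), I.card = d →
      1 - δ ≤ rssdProb m n s (fun M => IsDisjunctFor M I) → κ * Real.log n ≤ m := by
  set G := maxRate d with hG
  have hG0 : 0 < G := maxRate_pos hd
  set γ := (1 / κ - G) / 4 with hγ
  have hγ0 : 0 < γ := by
    have : G < 1 / κ := by rwa [lt_div_comm₀ hG0 hκ0]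
    rw [hγ]; linarith
  obtain ⟨ε, hε, hunif⟩ := exists_uniform_coverExponent hγ0
  have hcast : Tendsto (fun m : ℕ => (m : ℝ)) atTop atTop := tendsto_natCast_atTop_atTop
  have hlarge : ∀ᶠ m : ℕ in atTop, 1 / (ε ^ 2 * m) +
      Real.exp (-(1 / 2 * Real.exp (3 * γ * m - coverError m))) < 1 - δ := by
    have h1 : Tendsto (fun m : ℕ => 1 / (ε ^ 2 * (m : ℝ))) atTop (𝓝 0) :=
      tendsto_const_nhds.div_atTop (hcast.const_mul_atTop (by positivity))
    have h2 := Real.tendsto_exp_neg_atTop_nhds_zero.comp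
      ((Real.tendsto_exp_atTop.comp (tendsto_mul_sub_coverError
        (show 0 < 3 * γ by positivity))).const_mul_atTop (show (0 : ℝ) < 1 / 2 by norm_num))
    have h3 := h1.add h2
    rw [add_zero] at h3
    exact h3.eventually_lt_const (by linarith)
  obtain ⟨M, hM⟩ := eventually_atTop.mp hlarge
  have hsmall : ∀ᶠ n : ℕ in atTop, ((1 : ℝ) - 1 / 2 ^ (M + 1)) ^ (n - d) < 1 - δ := by
    have h0 : (0 : ℝ) < 1 / 2 ^ (M + 1) := by positivity
    have h1 : (1 : ℝ) / 2 ^ (M + 1) ≤ 1 := by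
      rw [div_le_one (by positivity)]; exact one_le_pow₀ (by norm_num)
    exact ((tendsto_pow_atTop_nhds_zero_of_lt_one (by linarith) (by linarith)).comp
      (tendsto_sub_atTop_nat d)).eventually_lt_const (by linarith)
  filter_upwards [hsmall, eventually_ge_atTop (2 * d)] with n hn1 hn2 m s hsm I hI hP
  by_contra hlt
  push Not at hlt
  have hInon : I.Nonempty := Finset.card_pos.mp (by omega)
  rcases lt_or_ge m (M + 1) with hmM | hmM
  · have h1 := rssdProb_isDisjunctFor_le_two_pow hsm I hInon
    have h2 : ((1 : ℝ) - 1 / 2 ^ m) ^ (n - I.card) ≤ (1 - 1 / 2 ^ (M + 1)) ^ (n - d) := by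
      rw [hI]
      have h3 : (1 : ℝ) / 2 ^ m ≤ 1 := by
        rw [div_le_one (by positivity)]; exact one_le_pow₀ (by norm_num)
      have h4 : (1 : ℝ) / 2 ^ (M + 1) ≤ 1 / 2 ^ m :=
        one_div_le_one_div_of_le (by positivity) (pow_le_pow_right₀ (by norm_num) hmM.le)
      exact pow_le_pow_left₀ (by linarith) (by linarith) _
    linarith
  have hm0 : 0 < m := by omega
  have hm' : (0 : ℝ) < m := by exact_mod_cast hm0
  set r := Real.exp (-(m * (G + γ)) - coverError m) with hr
  have hr1 : r ≤ 1 := by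
    rw [hr, Real.exp_le_one_iff]
    have := coverError_nonneg m
    have : 0 ≤ m * (G + γ) := by positivity
    linarith
  have hsI := natCast_div_mem_Icc hsm
  have h1 := rssdProb_isDisjunctFor_le hm0 hsm I hInon hε hr1 (by
    intro a hsa ham ha
    rw [hI] at ha
    refine le_trans ?_ (exp_le_coverRatio hm0 hsa ham)
    have h2 := (abs_lt.mp (hunif _ hsI _ (natCast_div_mem_Icc ham) _ (one_sub_pow_mem_Icc hsI d)
      ha)).2
    have h3 := weightRate_le_maxRate d hsI
    rw [weightRate] at h3
    have h4 : coverExponent (s / m) (a / m) ≤ G + γ := by linarith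
    rw [hr]
    gcongr)
  have hlogn : (m : ℝ) / κ < Real.log n := by rwa [div_lt_iff₀' hκ0]
  have hn0 : (0 : ℝ) < n := by
    have : 0 < n := by omega
    exact_mod_cast this
  have hnexp : Real.exp (m / κ) ≤ n := ((Real.lt_log_iff_exp_lt hn0).mp hlogn).le
  have hnd : (n : ℝ) / 2 ≤ ((n - d : ℕ) : ℝ) := by
    rw [Nat.cast_sub (by omega)]
    have : (2 : ℝ) * d ≤ n := by exact_mod_cast hn2
    linarith
  have h2 : (1 - r) ^ (n - I.card) ≤
      Real.exp (-(1 / 2 * Real.exp (3 * γ * m - coverError m))) := by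
    rw [hI]
    calc (1 - r) ^ (n - d) ≤ Real.exp (-r) ^ (n - d) :=
          pow_le_pow_left₀ (by linarith) (by linarith [Real.add_one_le_exp (-r)]) _
      _ = Real.exp (-(((n - d : ℕ) : ℝ) * r)) := by
          rw [← Real.exp_nat_mul]
          congr 1
          ring
      _ ≤ _ := by
          refine Real.exp_le_exp.mpr (neg_le_neg ?_)
          have h3 : Real.exp (3 * γ * m - coverError m) = Real.exp (m / κ) * r := by
            rw [hr, ← Real.exp_add, hγ]
            congr 1
            ring
          have hr0 : 0 < r := Real.exp_pos _
          rw [h3]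
          calc 1 / 2 * (Real.exp (m / κ) * r) ≤ 1 / 2 * (n * r) := by gcongr
            _ = n / 2 * r := by ring
            _ ≤ _ := by gcongr
  have := hM m (by omega)
  linarith

/-! ### Limits of the minimal number of tests -/

lemma eventually_minTestsDisjunct_le {d : ℕ} (hd : 1 ≤ d) {δ κ : ℝ} (hδ : 0 < δ)
    (hκ : 1 / maxRate d < κ) :
    ∀ᶠ n : ℕ in atTop, (minTestsDisjunct δ n d : ℝ) / Real.log n ≤ κ := by
  filter_upwards [eventually_exists_isIrredundantFor hd hδ hκ, eventually_gt_atTop 1]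
    with n ⟨m, s, hm, hsm, h⟩ hn
  rw [div_le_iff₀ (Real.log_pos (by exact_mod_cast hn))]
  refine le_trans ?_ hm
  exact Nat.cast_le.mpr <| Nat.sInf_le ⟨s, hsm, fun I hI => (h I hI).trans
    (rssdProb_mono fun C hC => IsIrredundantFor.isDisjunctFor hC)⟩

lemma eventually_minTests_le {d : ℕ} (hd : 1 ≤ d) {δ κ : ℝ} (hδ : 0 < δ)
    (hκ : 1 / maxRate d < κ) :
    ∀ᶠ n : ℕ in atTop, (minTests δ n d : ℝ) / Real.log n ≤ κ := by
  filter_upwards [eventually_exists_isIrredundantFor hd hδ hκ, eventually_gt_atTop 1]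
    with n ⟨m, s, hm, hsm, h⟩ hn
  rw [div_le_iff₀ (Real.log_pos (by exact_mod_cast hn))]
  refine le_trans ?_ hm
  exact Nat.cast_le.mpr <| Nat.sInf_le ⟨s, hsm, fun I hI => (h I hI).trans
    (rssdProb_mono fun C hC => IsIrredundantFor.isSeparableFor hC d)⟩

lemma eventually_le_minTestsDisjunct {d : ℕ} (hd : 1 ≤ d) {δ κ : ℝ} (hδ₀ : 0 < δ) (hδ₁ : δ < 1)
    (hκ : κ < 1 / maxRate d) :
    ∀ᶠ n : ℕ in atTop, κ ≤ (minTestsDisjunct δ n d : ℝ) / Real.log n := by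
  rcases le_or_gt κ 0 with h0 | h0
  · filter_upwards with n
    exact h0.trans (div_nonneg (Nat.cast_nonneg _) (Real.log_natCast_nonneg n))
  filter_upwards [eventually_exists_isIrredundantFor hd hδ₀ (lt_add_one (1 / maxRate d)),
    eventually_le_of_isDisjunctFor hd hδ₁ h0 hκ, eventually_gt_atTop 1, eventually_ge_atTop d]
    with n ⟨m, s, _, hsm, h⟩ hlow hn hnd
  -- The infimum of the empty set would be the junk value `0`.
  have hne : {m | ∃ s ≤ m, ∀ I : Finset (Fin n), I.card ≤ d →
      1 - δ ≤ rssdProb m n s fun M => IsDisjunctFor M I}.Nonempty :=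
    ⟨m, s, hsm, fun I hI => (h I hI).trans
      (rssdProb_mono fun C hC => IsIrredundantFor.isDisjunctFor hC)⟩
  obtain ⟨s', hs', hmem⟩ := Nat.sInf_mem hne
  obtain ⟨I, hI⟩ := Finset.exists_subset_card_eq (s := (Finset.univ : Finset (Fin n))) (n := d)
    (by simpa using hnd)
  rw [le_div_iff₀ (Real.log_pos (by exact_mod_cast hn))]
  exact hlow _ s' hs' I hI.2 (hmem I hI.2.le)

/-- Sets of `d` items already force as many tests for `d + 1` defective items as disjunctness. -/
lemma eventually_le_minTests_succ {d : ℕ} (hd : 1 ≤ d) {δ κ : ℝ} (hδ₀ : 0 < δ) (hδ₁ : δ < 1)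
    (hκ : κ < 1 / maxRate d) :
    ∀ᶠ n : ℕ in atTop, κ ≤ (minTests δ n (d + 1) : ℝ) / Real.log n := by
  rcases le_or_gt κ 0 with h0 | h0
  · filter_upwards with n
    exact h0.trans (div_nonneg (Nat.cast_nonneg _) (Real.log_natCast_nonneg n))
  filter_upwards [eventually_exists_isIrredundantFor (d := d + 1) (by omega) hδ₀
      (lt_add_one (1 / maxRate (d + 1))),
    eventually_le_of_isDisjunctFor hd hδ₁ h0 hκ, eventually_gt_atTop 1, eventually_ge_atTop d]
    with n ⟨m, s, _, hsm, h⟩ hlow hn hnd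
  have hne : {m | ∃ s ≤ m, ∀ I : Finset (Fin n), I.card ≤ d + 1 →
      1 - δ ≤ rssdProb m n s fun M => IsSeparableFor (d + 1) M I}.Nonempty :=
    ⟨m, s, hsm, fun I hI => (h I hI).trans
      (rssdProb_mono fun C hC => IsIrredundantFor.isSeparableFor hC _)⟩
  obtain ⟨s', hs', hmem⟩ := Nat.sInf_mem hne
  obtain ⟨I, hI⟩ := Finset.exists_subset_card_eq (s := (Finset.univ : Finset (Fin n))) (n := d)
    (by simpa using hnd)
  rw [le_div_iff₀ (Real.log_pos (by exact_mod_cast hn))]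
  exact hlow _ s' hs' I hI.2 ((hmem I (by omega)).trans
    (rssdProb_mono fun C hC => IsSeparableFor.isDisjunctFor (by omega) hC))

lemma tendsto_minTestsDisjunct {d : ℕ} (hd : 1 ≤ d) {δ : ℝ} (hδ₀ : 0 < δ) (hδ₁ : δ < 1) :
    Tendsto (fun n : ℕ => (minTestsDisjunct δ n d : ℝ) / Real.log n) atTop
      (𝓝 (1 / maxRate d)) := by
  refine tendsto_order.mpr ⟨fun a ha => ?_, fun a ha => ?_⟩
  · obtain ⟨κ, h1, h2⟩ := exists_between ha
    filter_upwards [eventually_le_minTestsDisjunct hd hδ₀ hδ₁ h2] with n hn using h1.trans_le hn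
  · obtain ⟨κ, h1, h2⟩ := exists_between ha
    filter_upwards [eventually_minTestsDisjunct_le hd hδ₀ h1] with n hn using hn.trans_lt h2

lemma upperConst_le {d : ℕ} (hd : 1 ≤ d) {δ : ℝ} (hδ₀ : 0 < δ) :
    upperConst δ d ≤ ((1 / maxRate d : ℝ) : EReal) := by
  refine EReal.le_of_forall_lt_iff_le.mp fun κ hκ => limsup_le_of_le (h := ?_)
  filter_upwards [eventually_minTests_le hd hδ₀ (EReal.coe_lt_coe_iff.mp hκ)] with n hn
  exact EReal.coe_le_coe_iff.mpr hn

lemma le_lowerConst_succ {d : ℕ} (hd : 1 ≤ d) {δ : ℝ} (hδ₀ : 0 < δ) (hδ₁ : δ < 1) :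
    ((1 / maxRate d : ℝ) : EReal) ≤ lowerConst δ (d + 1) := by
  refine EReal.ge_of_forall_gt_iff_ge.mp fun κ hκ => le_liminf_of_le (h := ?_)
  filter_upwards [eventually_le_minTests_succ hd hδ₀ hδ₁ (EReal.coe_lt_coe_iff.mp hκ)] with n hn
  exact EReal.coe_le_coe_iff.mpr hn

lemma lowerConst_le_upperConst (δ : ℝ) (d : ℕ) : lowerConst δ d ≤ upperConst δ d :=
  liminf_le_limsup

lemma tendsto_one_div_maxRate_div :
    Tendsto (fun d : ℕ => 1 / maxRate d / d) atTop (𝓝 (1 / Real.log 2 ^ 2)) := by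
  have hl : Real.log 2 ^ 2 ≠ 0 := pow_ne_zero 2 (Real.log_pos one_lt_two).ne'
  refine ((tendsto_const_nhds (x := (1 : ℝ))).div tendsto_mul_maxRate hl).congr fun d => ?_
  rw [Pi.div_apply, div_div, mul_comm (maxRate d)]

lemma tendsto_one_div_maxRate_pred_div :
    Tendsto (fun d : ℕ => 1 / maxRate (d - 1) / d) atTop (𝓝 (1 / Real.log 2 ^ 2)) := by
  rw [← tendsto_add_atTop_iff_nat 1]
  have h := tendsto_one_div_maxRate_div.mul (tendsto_natCast_div_add_atTop (1 : ℝ))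
  rw [mul_one] at h
  refine h.congr' ?_
  filter_upwards [eventually_ge_atTop 1] with d hd
  have hd' : (0 : ℝ) < d := by exact_mod_cast hd
  rw [Nat.add_sub_cancel]
  push_cast
  field_simp

/-- The constants for separability lie between those for disjunctness with `d - 1` and with `d`
items. -/
lemma tendsto_separable_constant_div {δ : ℝ} {c : ℕ → EReal}
    (hlow : ∀ d, lowerConst δ d ≤ c d) (hup : ∀ d, c d ≤ upperConst δ d)
    (hδ₀ : 0 < δ) (hδ₁ : δ < 1) :
    Tendsto (fun d : ℕ => c d / (d : EReal)) atTop (𝓝 ((1 / Real.log 2 ^ 2 : ℝ) : EReal)) := by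
  have hdiv : ∀ (x : ℝ) (d : ℕ), ((x / d : ℝ) : EReal) = (x : EReal) / (d : EReal) := fun x d => by
    rw [EReal.coe_div, EReal.coe_natCast]
  have hnn : ∀ d : ℕ, (0 : EReal) ≤ (d : EReal) := fun d => by
    rw [← EReal.coe_natCast]
    exact_mod_cast Nat.cast_nonneg (α := ℝ) d
  refine tendsto_of_tendsto_of_tendsto_of_le_of_le'
    ((continuous_coe_real_ereal.tendsto _).comp tendsto_one_div_maxRate_pred_div)
    ((continuous_coe_real_ereal.tendsto _).comp tendsto_one_div_maxRate_div) ?_ ?_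
  · filter_upwards [eventually_ge_atTop 2] with d hd
    obtain ⟨k, rfl⟩ : ∃ k, d = k + 1 := ⟨d - 1, by omega⟩
    simp only [Function.comp, hdiv, Nat.add_sub_cancel]
    exact EReal.div_le_div_right_of_nonneg (hnn _)
      ((le_lowerConst_succ (by omega) hδ₀ hδ₁).trans (hlow _))
  · filter_upwards [eventually_ge_atTop 1] with d hd
    simp only [Function.comp, hdiv]
    exact EReal.div_le_div_right_of_nonneg (hnn _) ((hup _).trans (upperConst_le hd hδ₀))

lemma abs_one_div_log_two_sq_sub_lt : |1 / Real.log 2 ^ 2 - 2.081| < 0.0005 := by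
  have h1 := Real.log_two_gt_d9
  have h2 := Real.log_two_lt_d9
  have h3 : (0 : ℝ) < Real.log 2 ^ 2 := by positivity
  rw [abs_lt]
  constructor
  · rw [lt_sub_iff_add_lt, lt_div_iff₀ h3]
    nlinarith
  · rw [sub_lt_iff_lt_add, div_lt_iff₀ h3]
    nlinarith

theorem theorem3 (δ : ℝ) (hδ₀ : 0 < δ) (hδ₁ : δ < 1) :
    (∃ c : ℕ → ℝ,
      (∀ d : ℕ, 1 ≤ d →
        Tendsto (fun n : ℕ => (minTestsDisjunct δ n d : ℝ) / Real.log n) atTop (𝓝 (c d)) ∧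
        ∃ R : ℝ, IsGreatest (rssdRate d '' Set.Ioc 0 (d : ℝ)) R ∧ 0 < R ∧
          c d = 1 / (Real.log 2 * R)) ∧
      Tendsto (fun d : ℕ => c d / d) atTop (𝓝 (1 / Real.log 2 ^ 2))) ∧
    Tendsto (fun d : ℕ => upperConst δ d / (d : EReal)) atTop
      (𝓝 ((1 / Real.log 2 ^ 2 : ℝ) : EReal)) ∧
    Tendsto (fun d : ℕ => lowerConst δ d / (d : EReal)) atTop
      (𝓝 ((1 / Real.log 2 ^ 2 : ℝ) : EReal)) ∧
    |1 / Real.log 2 ^ 2 - 2.081| < 0.0005 := by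
  refine ⟨⟨fun d => 1 / maxRate d, fun d hd => ⟨tendsto_minTestsDisjunct hd hδ₀ hδ₁,
    maxRate d / Real.log 2, isGreatest_rssdRate hd,
    div_pos (maxRate_pos hd) (Real.log_pos one_lt_two), ?_⟩, tendsto_one_div_maxRate_div⟩,
    tendsto_separable_constant_div (lowerConst_le_upperConst δ) (fun _ => le_rfl) hδ₀ hδ₁,
    tendsto_separable_constant_div (fun _ => le_rfl) (lowerConst_le_upperConst δ) hδ₀ hδ₁,
    abs_one_div_log_two_sq_sub_lt⟩
  rw [mul_div_cancel₀ _ (Real.log_pos one_lt_two).ne']
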